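/- Let $X$ and $Y$ be jointly Gaussian random vectors in $\mathbb{R}^{d_x}$ and $\mathbb{R}^{d_y}$ with nonsingular covariance matrices $\Sigma_X,\Sigma_Y$ and cross-covariance matrix $\Sigma_{XY}$, and let $1\le k\le \min(d_x,d_y)$. Write $\mathsf{I}(U;V)=D_{\mathrm{KL}}(P_{UV}\,\|\,P_U\otimes P_V)\in[0,\infty]$ for mutual information, and $$\mathsf{mSMI}_k(X;Y)=\sup\{\mathsf{I}(A^{\top}X;B^{\top}Y):\ A\in\mathbb{R}^{d_x\times k},\ B\in\mathbb{R}^{d_y\times k},\ A^{\top}A=B^{\top}B=I_k\}.$$ Let $T_{XY}=\Sigma_X^{-1/2}\Sigma_{XY}\Sigma_Y^{-1/2}$, with singular values $\sigma_1(T_{XY})\ge\sigma_2(T_{XY})\ge\cdots$. A $k$-dimensional CCA solution is a pair $(A,B)\in\mathbb{R}^{d_x\times k}\times\mathbb{R}^{d_y\times k}$ that maximizes $\operatorname{tr}(A^{\top}\Sigma_{XY}B)$ subject to $A^{\top}\Sigma_XA=B^{\top}\Sigma_YB=I_k$. Then $\sigma_i(T_{XY})\le 1$ for all $i$. CCA solutions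 exist: there are matrices $U_k$ and $V_k$ whose columns are orthonormal, matching left and right singular vectors of $T_{XY}$ for its $k$ largest singular values, and for all such $U_k,V_k$ the pair $(\Sigma_X^{-1/2}U_k,\Sigma_Y^{-1/2}V_k)$ is a CCA solution. For every $k$-dimensional CCA solution $(A_{\mathsf{CCA}},B_{\mathsf{CCA}})$, $$\mathsf{mSMI}_k(X;Y)=\mathsf{I}(A_{\mathsf{CCA}}^{\top}X;B_{\mathsf{CCA}}^{\top}Y)=-\frac12\sum_{i=1}^k\log\big(1-\sigma_i(T_{XY})^2\big),$$ where $\log 0=-\infty$, so that all three quantities are $+\infty$ if $\sigma_1(T_{XY})=1$. For $k=1$: let $\rho_{\mathsf{CCA}}(X,Y)$ be the supremum of the correlation coefficient $\rho(\theta^{\top}X,\phi^{\top}Y)$ over nonzero $\theta\in\mathbb{R}^{d_x}$, $\phi\in\mathbb{R}^{d_y}$. This supremum is attained, and for every maximizing pair $(\theta_{\mathsf{CCA}},\phi_{\mathsf{CCA}})$, $$\mathsf{mSMI}_1(X;Y)=\mathsf{I}(\theta_{\mathsf{CCA}}^{\top}X;\phi_{\mathsf{CCA}}^{\top}Y)=-\frac12\log\big(1-\rho_{\mathsf{CCA}}(X,Y)^2\big).$$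 -/

import Mathlib

open MeasureTheory ProbabilityTheory InformationTheory
open scoped ENNReal Matrix MatrixOrder

noncomputable section

namespace MaxSliced

variable {Ω : Type*} [MeasurableSpace Ω]

/-- Mutual information `I(U; V) = KL(P_{UV} ‖ P_U ⊗ P_V)`, with values in `[0, ∞]`. -/
def mutualInfo {E F : Type*} [MeasurableSpace E] [MeasurableSpace F]
    (U : Ω → E) (V : Ω → F) (P : Measure Ω) : ℝ≥0∞ :=
  klDiv (P.map (fun ω => (U ω, V ω))) ((P.map U).prod (P.map V))

/-- The Stiefel manifold of `d × k` matrices with orthonormal columns. -/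
def stiefel (k d : ℕ) : Set (Matrix (Fin d) (Fin k) ℝ) := {A | Aᵀ * A = 1}

/-- The mutual information `I(Aᵀ X; Bᵀ Y)` between linear images of `X` and `Y`. -/
def projInfo {dx dy k : ℕ} (X : Ω → Fin dx → ℝ) (Y : Ω → Fin dy → ℝ) (P : Measure Ω)
    (A : Matrix (Fin dx) (Fin k) ℝ) (B : Matrix (Fin dy) (Fin k) ℝ) : ℝ≥0∞ :=
  mutualInfo (fun ω => Aᵀ *ᵥ X ω) (fun ω => Bᵀ *ᵥ Y ω) P

/-- The `k`-dimensional max-sliced mutual information. -/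
def mSMI {dx dy : ℕ} (k : ℕ) (X : Ω → Fin dx → ℝ) (Y : Ω → Fin dy → ℝ) (P : Measure Ω) : ℝ≥0∞ :=
  ⨆ A ∈ stiefel k dx, ⨆ B ∈ stiefel k dy, projInfo X Y P A B

/-- The cross-covariance matrix `Σ_{XY}`. -/
def crossCov {dx dy : ℕ} (X : Ω → Fin dx → ℝ) (Y : Ω → Fin dy → ℝ) (P : Measure Ω) :
    Matrix (Fin dx) (Fin dy) ℝ :=
  Matrix.of fun i j => cov[fun ω => X ω i, fun ω => Y ω j; P]

/-- The covariance matrix `Σ_X`. -/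
def covMat {d : ℕ} (X : Ω → Fin d → ℝ) (P : Measure Ω) : Matrix (Fin d) (Fin d) ℝ :=
  crossCov X X P

/-- `S^{-1/2}` for a positive definite matrix `S`: the inverse of its positive square root. -/
def invSqrt {d : ℕ} (S : Matrix (Fin d) (Fin d) ℝ) : Matrix (Fin d) (Fin d) ℝ :=
  (CFC.sqrt S)⁻¹

/-- `T_{XY} = Σ_X^{-1/2} Σ_{XY} Σ_Y^{-1/2}`. -/
def corrMat {dx dy : ℕ} (X : Ω → Fin dx → ℝ) (Y : Ω → Fin dy → ℝ) (P : Measure Ω) :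
    Matrix (Fin dx) (Fin dy) ℝ :=
  invSqrt (covMat X P) * crossCov X Y P * invSqrt (covMat Y P)

/-- The singular values of a real matrix in decreasing order, indexed from `0` (the largest one),
and continued by zeros. -/
def sv {m n : ℕ} (T : Matrix (Fin m) (Fin n) ℝ) (i : ℕ) : ℝ :=
  (Matrix.toEuclideanLin T).singularValues i

/-- The columns of `U` and `V` are matching orthonormal left and right singular vectors of `T`
for its `k` largest singular values. -/
structure IsTopSingular {m n k : ℕ} (T : Matrix (Fin m) (Fin n) ℝ)
    (U : Matrix (Fin m) (Fin k) ℝ) (V : Matrix (Fin n) (Fin k) ℝ) : Prop where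
  left_orthonormal : Uᵀ * U = 1
  right_orthonormal : Vᵀ * V = 1
  mul_right : T * V = U * Matrix.diagonal (fun i : Fin k => sv T i)
  mul_left : Tᵀ * U = V * Matrix.diagonal (fun i : Fin k => sv T i)

/-- The constraint of `k`-dimensional CCA: `Aᵀ Σ_X A = Bᵀ Σ_Y B = I_k`. -/
def CCAFeasible {dx dy k : ℕ} (X : Ω → Fin dx → ℝ) (Y : Ω → Fin dy → ℝ) (P : Measure Ω)
    (A : Matrix (Fin dx) (Fin k) ℝ) (B : Matrix (Fin dy) (Fin k) ℝ) : Prop :=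
  Aᵀ * covMat X P * A = 1 ∧ Bᵀ * covMat Y P * B = 1

/-- `(A, B)` solves the `k`-dimensional CCA problem: it maximizes `tr (Aᵀ Σ_{XY} B)` subject to
`Aᵀ Σ_X A = Bᵀ Σ_Y B = I_k`. -/
structure IsCCASolution {dx dy k : ℕ} (X : Ω → Fin dx → ℝ) (Y : Ω → Fin dy → ℝ) (P : Measure Ω)
    (A : Matrix (Fin dx) (Fin k) ℝ) (B : Matrix (Fin dy) (Fin k) ℝ) : Prop where
  feasible : CCAFeasible X Y P A B
  optimal : ∀ (A' : Matrix (Fin dx) (Fin k) ℝ) (B' : Matrix (Fin dy) (Fin k) ℝ),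
    CCAFeasible X Y P A' B' →
      (A'ᵀ * crossCov X Y P * B').trace ≤ (Aᵀ * crossCov X Y P * B).trace

/-- Pearson's correlation coefficient of two real random variables. -/
def corr (U V : Ω → ℝ) (P : Measure Ω) : ℝ :=
  cov[U, V; P] / √(Var[U; P] * Var[V; P])

/-- The correlation coefficient `ρ(θᵀ X, φᵀ Y)`. -/
def projCorr {dx dy : ℕ} (X : Ω → Fin dx → ℝ) (Y : Ω → Fin dy → ℝ) (P : Measure Ω)
    (θ : Fin dx → ℝ) (φ : Fin dy → ℝ) : ℝ :=
  corr (fun ω => θ ⬝ᵥ X ω) (fun ω => φ ⬝ᵥ Y ω) P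

/-- The canonical correlation coefficient `ρ_CCA(X, Y)`. -/
def rhoCCA {dx dy : ℕ} (X : Ω → Fin dx → ℝ) (Y : Ω → Fin dy → ℝ) (P : Measure Ω) : ℝ :=
  sSup {r | ∃ θ φ, θ ≠ 0 ∧ φ ≠ 0 ∧ r = projCorr X Y P θ φ}

/-- `(θ, φ)` is a pair of nonzero vectors that maximizes the correlation `ρ(θᵀ X, φᵀ Y)`. -/
structure IsCCAPair {dx dy : ℕ} (X : Ω → Fin dx → ℝ) (Y : Ω → Fin dy → ℝ) (P : Measure Ω)
    (θ : Fin dx → ℝ) (φ : Fin dy → ℝ) : Prop where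
  left_ne : θ ≠ 0
  right_ne : φ ≠ 0
  optimal : ∀ θ' φ', θ' ≠ 0 → φ' ≠ 0 → projCorr X Y P θ' φ' ≤ projCorr X Y P θ φ

/-- The natural logarithm on `[0, ∞)` with `log 0 = -∞`. -/
def extLog (x : ℝ) : EReal := ENNReal.log (ENNReal.ofReal x)

end MaxSliced

end

/-! Mutual information is unchanged by invertible linear maps of either argument, so `projInfo`
depends only on the column spaces of A and B. The orthonormality constraint may therefore be traded
for the CCA constraint AᵀΣ_X A = BᵀΣ_Y B = 1 (`projInfo_mul`, `exists_mul_orthonormal`). Under it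
both projections are white; rotating by singular vectors of the k × k matrix AᵀΣ_{XY}B makes the
cross-covariance diagonal too, and the information splits into k independent Gaussian pairs
(`projInfo_of_feasible`).

With U = Σ_X^{1/2}A and V = Σ_Y^{1/2}B, that matrix is the compression UᵀTV of T = `corrMat` by
orthonormal columns. Compression does not increase singular values (`sv_compression_le`), and the
information of a pair grows with its correlation, so the supremum is reached at the top singular
vectors (`mSMI_eq_sum`). An arbitrary CCA solution need not consist of singular vectors, but
maximality of the trace forces its compression to have the top singular values of T
(`sv_compression_eq_of_sum_le_trace`), which is all that the information sees. The one-dimensional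
claims follow by rescaling to unit variances. -/

namespace MaxSliced

/-! ### Kullback–Leibler divergence of image and product measures. -/

section KL

variable {α β : Type*} [MeasurableSpace α] [MeasurableSpace β]

/-- Data processing inequality, applied to `e` and to its inverse. -/
lemma klDiv_map_measurableEquiv (μ ν : Measure α) [IsFiniteMeasure μ] [IsFiniteMeasure ν]
    (e : α ≃ᵐ β) : klDiv (μ.map e) (ν.map e) = klDiv μ ν := by
  refine le_antisymm (klDiv_map_le μ ν e.measurable) ?_
  have h := klDiv_map_le (μ.map e) (ν.map e) e.symm.measurable
  simpa [Measure.map_map e.symm.measurable e.measurable] using h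

/-- Chain rule with constant kernels. Its conditional term compares two products with the same first
factor; after swapping coordinates they share a kernel, which drops out. -/
lemma klDiv_prod (μ μ' : Measure α) (ν ν' : Measure β) [IsProbabilityMeasure μ]
    [IsProbabilityMeasure μ'] [IsProbabilityMeasure ν] [IsProbabilityMeasure ν'] :
    klDiv (μ.prod ν) (μ'.prod ν') = klDiv μ μ' + klDiv ν ν' := by
  rw [← Measure.compProd_const, ← Measure.compProd_const, klDiv_compProd_eq_add,
    Measure.compProd_const, Measure.compProd_const,
    ← klDiv_map_measurableEquiv _ _ (MeasurableEquiv.prodComm (α := α) (β := β))]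
  congr 1
  have h (ρ : Measure β) [IsProbabilityMeasure ρ] :
      (μ.prod ρ).map (MeasurableEquiv.prodComm (α := α) (β := β)) = ρ.prod μ := Measure.prod_swap
  rw [h, h, ← Measure.compProd_const, ← Measure.compProd_const, klDiv_compProd_left]

lemma klDiv_pi {n : ℕ} (μ ν : Fin n → Measure α) [∀ i, IsProbabilityMeasure (μ i)]
    [∀ i, IsProbabilityMeasure (ν i)] :
    klDiv (Measure.pi μ) (Measure.pi ν) = ∑ i, klDiv (μ i) (ν i) := by
  induction n with
  | zero =>
    rw [Measure.pi_of_empty μ, Measure.pi_of_empty ν]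
    simp [klDiv_self]
  | succ n ih =>
    have h (ρ : Fin (n + 1) → Measure α) [∀ i, IsProbabilityMeasure (ρ i)] :=
      (measurePreserving_piFinSuccAbove ρ 0).map_eq
    rw [← klDiv_map_measurableEquiv _ _ (MeasurableEquiv.piFinSuccAbove (fun _ => α) 0), h, h,
      klDiv_prod, ih, Fin.sum_univ_succ]
    simp

end KL

/-! ### Invariance and additivity of mutual information. -/

section MutualInfo

variable {Ω : Type*} [MeasurableSpace Ω] {P : Measure Ω} [IsProbabilityMeasure P]
  {E F E' F' : Type*} [MeasurableSpace E] [MeasurableSpace F]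
  [MeasurableSpace E'] [MeasurableSpace F']

lemma mutualInfo_comp_measurableEquiv {U : Ω → E} {V : Ω → F} (hU : AEMeasurable U P)
    (hV : AEMeasurable V P) (e : E ≃ᵐ E') (f : F ≃ᵐ F') :
    mutualInfo (fun ω => e (U ω)) (fun ω => f (V ω)) P = mutualInfo U V P := by
  have := Measure.isProbabilityMeasure_map hU
  have := Measure.isProbabilityMeasure_map hV
  have := Measure.isProbabilityMeasure_map (hU.prodMk hV)
  unfold mutualInfo
  rw [← klDiv_map_measurableEquiv _ _ (MeasurableEquiv.prodCongr e f),
    AEMeasurable.map_map_of_aemeasurable (MeasurableEquiv.measurable _).aemeasurable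
      (hU.prodMk hV)]
  congr 1
  have h1 : P.map (fun ω => e (U ω)) = (P.map U).map e :=
    (AEMeasurable.map_map_of_aemeasurable e.measurable.aemeasurable hU).symm
  have h2 : P.map (fun ω => f (V ω)) = (P.map V).map f :=
    (AEMeasurable.map_map_of_aemeasurable f.measurable.aemeasurable hV).symm
  rw [h1, h2, Measure.map_prod_map _ _ e.measurable f.measurable]
  rfl

/-- Mutual information is additive over independent pairs. -/
lemma mutualInfo_pi {n : ℕ} {U : Fin n → Ω → E} {V : Fin n → Ω → F}
    (hU : ∀ i, AEMeasurable (U i) P) (hV : ∀ i, AEMeasurable (V i) P)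
    (h : iIndepFun (fun i ω => (U i ω, V i ω)) P) :
    mutualInfo (fun ω i => U i ω) (fun ω i => V i ω) P = ∑ i, mutualInfo (U i) (V i) P := by
  have := fun i => Measure.isProbabilityMeasure_map (hU i)
  have := fun i => Measure.isProbabilityMeasure_map (hV i)
  have := fun i => Measure.isProbabilityMeasure_map ((hU i).prodMk (hV i))
  have hUi : iIndepFun U P := h.comp (fun _ => Prod.fst) (fun _ => measurable_fst)
  have hVi : iIndepFun V P := h.comp (fun _ => Prod.snd) (fun _ => measurable_snd)
  have h0 := (iIndepFun_iff_map_fun_eq_pi_map fun i => (hU i).prodMk (hV i)).1 h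
  have h1 := (iIndepFun_iff_map_fun_eq_pi_map hU).1 hUi
  have h2 := (iIndepFun_iff_map_fun_eq_pi_map hV).1 hVi
  unfold mutualInfo
  rw [← klDiv_pi, ← h0, h1, h2]
  -- Additivity concerns tuples of pairs, mutual information a pair of tuples; this equivalence
  -- carries one to the other.
  have e := measurePreserving_arrowProdEquivProdArrow E F (Fin n) (fun i => P.map (U i))
    (fun i => P.map (V i))
  rw [← e.map_eq, ← klDiv_map_measurableEquiv (P.map _) _
    (MeasurableEquiv.arrowProdEquivProdArrow E F (Fin n)),
    AEMeasurable.map_map_of_aemeasurable (MeasurableEquiv.measurable _).aemeasurable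
      (aemeasurable_pi_lambda _ fun i => (hU i).prodMk (hV i))]
  rfl

end MutualInfo

/-- The mutual information of two real Gaussian variables with correlation coefficient `c`. -/
noncomputable def gaussInfo (c : ℝ) : ℝ≥0∞ :=
  if c ^ 2 < 1 then ENNReal.ofReal (-(1 / 2) * Real.log (1 - c ^ 2)) else ⊤

lemma gaussInfo_le_gaussInfo {c d : ℝ} (hc : 0 ≤ c) (hcd : c ≤ d) :
    gaussInfo c ≤ gaussInfo d := by
  have h : c ^ 2 ≤ d ^ 2 := by gcongr
  unfold gaussInfo
  split_ifs with h1 h2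
  · refine ENNReal.ofReal_le_ofReal ?_
    have := Real.log_le_log (by linarith : 0 < 1 - d ^ 2) (by linarith : 1 - d ^ 2 ≤ 1 - c ^ 2)
    linarith
  · exact le_top
  · linarith
  · exact le_top

/-- In the degenerate case c² = 1 both sides are +∞, the right one being a negative multiple of log
0 = -∞. -/
lemma coe_gaussInfo {c : ℝ} (hc : c ^ 2 ≤ 1) :
    (gaussInfo c : EReal) = ((-(1 / 2) : ℝ) : EReal) * extLog (1 - c ^ 2) := by
  unfold gaussInfo extLog
  split_ifs with h
  · have hp : 0 < 1 - c ^ 2 := by linarith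
    have hl : Real.log (1 - c ^ 2) ≤ 0 := Real.log_nonpos hp.le (by nlinarith)
    rw [ENNReal.log_ofReal_of_pos hp, EReal.coe_ennreal_ofReal, max_eq_left (by linarith),
      EReal.coe_mul]
  · have : 1 - c ^ 2 = 0 := by linarith
    rw [this]
    simp only [ENNReal.ofReal_zero, ENNReal.log_zero, EReal.coe_ennreal_top]
    rw [EReal.coe_mul_bot_of_neg (by norm_num)]

lemma extLog_nonpos {x : ℝ} (hx : x ≤ 1) : extLog x ≤ 0 := by
  unfold extLog
  rw [← ENNReal.log_one]
  exact ENNReal.log_monotone (by simpa using hx)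

/-- Distributivity can fail in `EReal` when infinities of opposite sign meet. Here both summands
have the same sign, and negating them reduces to the nonnegative case. -/
lemma mul_add_of_nonpos {x y : EReal} (hx : x ≤ 0) (hy : y ≤ 0) {r : ℝ} :
    (r : EReal) * (x + y) = r * x + r * y := by
  have hx' : x ≠ ⊤ := (hx.trans_lt EReal.zero_lt_top).ne
  have hy' : y ≠ ⊤ := (hy.trans_lt EReal.zero_lt_top).ne
  have h := EReal.left_distrib_of_nonneg (c := ((-r : ℝ) : EReal))
    (EReal.neg_nonneg.2 hx) (EReal.neg_nonneg.2 hy)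
  rw [← sub_eq_add_neg, ← EReal.neg_add (.inr hy') (.inl hx')] at h
  simpa only [EReal.coe_neg, neg_mul_neg] using h

lemma coe_sum_gaussInfo {ι : Type*} (s : Finset ι) {c : ι → ℝ} (hc : ∀ i ∈ s, c i ^ 2 ≤ 1) :
    ((∑ i ∈ s, gaussInfo (c i) : ℝ≥0∞) : EReal) =
      ((-(1 / 2) : ℝ) : EReal) * ∑ i ∈ s, extLog (1 - c i ^ 2) := by
  classical
  induction s using Finset.induction_on with
  | empty => simp
  | insert i s hi ih =>
    have h1 : extLog (1 - c i ^ 2) ≤ 0 := extLog_nonpos (by nlinarith)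
    have h2 : ∑ j ∈ s, extLog (1 - c j ^ 2) ≤ 0 :=
      Finset.sum_nonpos fun j _ => extLog_nonpos (by nlinarith)
    rw [Finset.sum_insert hi, Finset.sum_insert hi, EReal.coe_ennreal_add,
      ih fun j hj => hc j (Finset.mem_insert_of_mem hj), coe_gaussInfo (hc i (by simp)),
      mul_add_of_nonpos h1 h2]

/-! ### Mutual information of a Gaussian pair. -/

section Pair

variable {Ω : Type*} [MeasurableSpace Ω] {P : Measure Ω} [IsProbabilityMeasure P] {U V : Ω → ℝ}

/-- The logarithm of the density of a Gaussian pair with unit variances and correlation `c`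
with respect to the product of its marginals. -/
noncomputable def pairLogDensity (a b c : ℝ) (p : ℝ × ℝ) : ℝ :=
  -(1 / 2) * Real.log (1 - c ^ 2) - (p.2 - (c * p.1 + (b - c * a))) ^ 2 / (2 * (1 - c ^ 2))
    + (p.2 - b) ^ 2 / 2

lemma measurable_pairLogDensity (a b c : ℝ) : Measurable (pairLogDensity a b c) := by
  unfold pairLogDensity; fun_prop

/-- Given U = u, the variable V is Gaussian with mean cu + (b - ca) and variance 1 - c²; the
exponential is the ratio of this conditional density to the marginal one. -/
lemma gaussianPDF_mul_pairLogDensity {a b c : ℝ} (hc : c ^ 2 < 1) (p : ℝ × ℝ) :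
    gaussianPDF b 1 p.2 * ENNReal.ofReal (Real.exp (pairLogDensity a b c p)) =
      gaussianPDF (c * p.1 + (b - c * a)) (1 - c ^ 2).toNNReal p.2 := by
  have hs : 0 < 1 - c ^ 2 := by linarith
  have hexp : Real.exp (-(1 / 2) * Real.log (1 - c ^ 2)) = (√(1 - c ^ 2))⁻¹ := by
    rw [Real.sqrt_eq_rpow, ← Real.rpow_neg hs.le, Real.rpow_def_of_pos hs]
    ring_nf
  rw [gaussianPDF, gaussianPDF, ← ENNReal.ofReal_mul (gaussianPDFReal_nonneg _ _ _)]
  congr 1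
  unfold gaussianPDFReal pairLogDensity
  rw [Real.exp_add, Real.exp_sub, hexp, Real.coe_toNNReal _ hs.le,
    Real.sqrt_mul (by positivity) (1 - c ^ 2)]
  simp only [NNReal.coe_one, mul_one, mul_inv, neg_div, Real.exp_neg]
  have := Real.exp_pos ((p.2 - b) ^ 2 / 2)
  field_simp

/-- V - cU is the residual of the regression of V on U. Its variance is the conditional variance of
V, and its nonnegativity bounds the correlation. -/
lemma variance_sub_covariance_mul (hU2 : MemLp U 2 P) (hV2 : MemLp V 2 P)
    (hU : Var[U; P] = 1) (hV : Var[V; P] = 1) :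
    Var[fun ω => V ω - cov[U, V; P] * U ω; P] = 1 - cov[U, V; P] ^ 2 := by
  set c := cov[U, V; P] with hcdef
  have hcU : MemLp (fun ω => c * U ω) 2 P := hU2.const_mul c
  have hR2 : MemLp (fun ω => V ω - c * U ω) 2 P := hV2.sub hcU
  rw [← covariance_self hR2.aemeasurable,
    covariance_fun_sub_fun_sub hV2 hcU hV2 hcU, covariance_self hV2.aemeasurable,
    covariance_const_mul_left, covariance_const_mul_right, covariance_const_mul_left,
    covariance_const_mul_right, covariance_self hU2.aemeasurable, covariance_comm V U, hU, hV,
    ← hcdef]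
  ring

lemma covariance_sq_le_one (hU2 : MemLp U 2 P) (hV2 : MemLp V 2 P)
    (hU : Var[U; P] = 1) (hV : Var[V; P] = 1) : cov[U, V; P] ^ 2 ≤ 1 :=
  sub_nonneg.1 (variance_sub_covariance_mul hU2 hV2 hU hV ▸ variance_nonneg _ P)

lemma map_pair_eq_withDensity (h : HasGaussianLaw (fun ω => (U ω, V ω)) P)
    (hU : Var[U; P] = 1) (hV : Var[V; P] = 1) (hc : cov[U, V; P] ^ 2 < 1) :
    P.map (fun ω => (U ω, V ω)) = ((P.map U).prod (P.map V)).withDensity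
      (fun p => ENNReal.ofReal (Real.exp (pairLogDensity P[U] P[V] cov[U, V; P] p))) := by
  set c := cov[U, V; P] with hcdef
  set a := P[U]
  set b := P[V]
  set R : Ω → ℝ := fun ω => V ω - c * U ω with hR
  have hUl := h.fst
  have hVl := h.snd
  have hmeas := (measurable_pairLogDensity a b c).exp.ennreal_ofReal
  have hs : 0 < 1 - c ^ 2 := by linarith
  have hs' : (1 - c ^ 2).toNNReal ≠ 0 := by simpa using hc
  have hUR : HasGaussianLaw (fun ω => (U ω, R ω)) P :=
    h.map ((ContinuousLinearMap.fst ℝ ℝ ℝ).prod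
      (ContinuousLinearMap.snd ℝ ℝ ℝ - c • ContinuousLinearMap.fst ℝ ℝ ℝ))
  have hU2 := hUl.memLp_two
  have hV2 := hVl.memLp_two
  have hcU : MemLp (fun ω => c * U ω) 2 P := hU2.const_mul c
  -- The residual is uncorrelated with U, hence independent of it by joint Gaussianity; the joint
  -- law is then a shear of P_U ⊗ P_R.
  have hind : IndepFun U R P := by
    refine hUR.indepFun_of_covariance_eq_zero ?_
    rw [hR, covariance_fun_sub_right hU2 hV2 hcU, covariance_const_mul_right,
      covariance_self hUl.aemeasurable, hU]
    simp [hcdef]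
  have hRvar : Var[R; P] = 1 - c ^ 2 := variance_sub_covariance_mul hU2 hV2 hU hV
  have hRmean : P[R] = b - c * a := by
    rw [hR, integral_sub hVl.integrable (hUl.integrable.const_mul c), integral_const_mul]
  have hRlaw : P.map R = gaussianReal (b - c * a) (1 - c ^ 2).toNNReal := by
    rw [hUR.snd.map_eq_gaussianReal, hRvar, hRmean]
  have hVlaw : P.map V = gaussianReal b 1 := by
    rw [hVl.map_eq_gaussianReal, hV]; simp [b]
  have := Measure.isProbabilityMeasure_map hUl.aemeasurable
  have hjoint : P.map (fun ω => (U ω, V ω)) =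
      ((P.map U).prod (P.map R)).map (fun q : ℝ × ℝ => (q.1, c * q.1 + q.2)) := by
    rw [← (indepFun_iff_map_prod_eq_prod_map_map hUl.aemeasurable hUR.snd.aemeasurable).1 hind,
      AEMeasurable.map_map_of_aemeasurable (by fun_prop) hUR.aemeasurable]
    congr 1
    ext ω <;> simp [hR]
  refine Measure.ext_of_lintegral _ fun f hf => ?_
  rw [hjoint, lintegral_map hf (by fun_prop), hRlaw, hVlaw,
    lintegral_withDensity_eq_lintegral_mul _ hmeas hf, lintegral_prod _ (by fun_prop),
    lintegral_prod _ (by fun_prop)]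
  refine lintegral_congr fun u => ?_
  have hfu : Measurable fun v => f (u, v) := by fun_prop
  rw [← lintegral_map (f := fun v => f (u, v)) (g := fun r => c * u + r) hfu (by fun_prop),
    gaussianReal_map_const_add, gaussianReal_of_var_ne_zero _ hs',
    gaussianReal_of_var_ne_zero _ one_ne_zero,
    lintegral_withDensity_eq_lintegral_mul _ (measurable_gaussianPDF _ _) hfu,
    lintegral_withDensity_eq_lintegral_mul _ (measurable_gaussianPDF _ _) (by fun_prop)]
  refine lintegral_congr fun v => ?_
  simp only [Pi.mul_apply]
  rw [← mul_assoc, gaussianPDF_mul_pairLogDensity hc (u, v), add_comm (b - c * a)]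

lemma mutualInfo_gaussian_pair_of_sq_lt (h : HasGaussianLaw (fun ω => (U ω, V ω)) P)
    (hU : Var[U; P] = 1) (hV : Var[V; P] = 1) (hc : cov[U, V; P] ^ 2 < 1) :
    mutualInfo U V P = ENNReal.ofReal (-(1 / 2) * Real.log (1 - cov[U, V; P] ^ 2)) := by
  have hmap := map_pair_eq_withDensity h hU hV hc
  set c := cov[U, V; P] with hcdef
  set a := P[U]
  set b := P[V]
  have hUl := h.fst
  have hVl := h.snd
  have hs : 0 < 1 - c ^ 2 := by linarith
  have := Measure.isProbabilityMeasure_map hUl.aemeasurable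
  have := Measure.isProbabilityMeasure_map hVl.aemeasurable
  have := Measure.isProbabilityMeasure_map h.aemeasurable
  have hmeas := measurable_pairLogDensity a b c
  have hac : P.map (fun ω => (U ω, V ω)) ≪ (P.map U).prod (P.map V) := by
    rw [hmap]; exact withDensity_absolutelyContinuous _ _
  have hllr : llr (P.map (fun ω => (U ω, V ω))) ((P.map U).prod (P.map V))
      =ᵐ[P.map (fun ω => (U ω, V ω))] pairLogDensity a b c := by
    refine hac.ae_le ?_
    rw [hmap]
    filter_upwards [Measure.rnDeriv_withDensity ((P.map U).prod (P.map V))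
      hmeas.exp.ennreal_ofReal] with p hp
    rw [llr, hp, ENNReal.toReal_ofReal (Real.exp_pos _).le, Real.log_exp]
  set R : Ω → ℝ := fun ω => V ω - c * U ω with hR
  have hU2 := hUl.memLp_two
  have hV2 := hVl.memLp_two
  have hcU : MemLp (fun ω => c * U ω) 2 P := hU2.const_mul c
  have hR2 : MemLp R 2 P := hV2.sub hcU
  have hRvar : Var[R; P] = 1 - c ^ 2 := variance_sub_covariance_mul hU2 hV2 hU hV
  have hRmean : P[R] = b - c * a := by
    rw [hR, integral_sub hVl.integrable (hUl.integrable.const_mul c), integral_const_mul]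
  have hVi : Integrable (fun ω => (V ω - b) ^ 2) P := (hV2.sub (memLp_const b)).integrable_sq
  have hRi : Integrable (fun ω => (R ω - P[R]) ^ 2) P :=
    (hR2.sub (memLp_const _)).integrable_sq
  have hform : (fun ω => pairLogDensity a b c (U ω, V ω)) = fun ω =>
      -(1 / 2) * Real.log (1 - c ^ 2) - (R ω - P[R]) ^ 2 / (2 * (1 - c ^ 2))
        + (V ω - b) ^ 2 / 2 := by
    ext ω
    rw [hRmean, hR, pairLogDensity]
    ring
  have hint : Integrable (fun ω => pairLogDensity a b c (U ω, V ω)) P := by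
    rw [hform]
    exact ((integrable_const _).sub (hRi.div_const _)).add (hVi.div_const _)
  -- The quadratic terms have expectations -1/2 and +1/2 and cancel.
  have hval : ∫ ω, pairLogDensity a b c (U ω, V ω) ∂P = -(1 / 2) * Real.log (1 - c ^ 2) := by
    rw [hform, integral_add (by exact (integrable_const _).sub (hRi.div_const _)) (hVi.div_const _),
      integral_sub (integrable_const _) (hRi.div_const _), integral_div, integral_div,
      ← variance_eq_integral hR2.aemeasurable, ← variance_eq_integral hV2.aemeasurable, hRvar, hV]
    simp only [integral_const, probReal_univ, one_smul]
    field_simp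
    ring
  have hint' : Integrable (llr (P.map (fun ω => (U ω, V ω))) ((P.map U).prod (P.map V)))
      (P.map (fun ω => (U ω, V ω))) := by
    refine Integrable.congr ?_ hllr.symm
    rw [integrable_map_measure hmeas.aestronglyMeasurable h.aemeasurable]
    exact hint
  rw [mutualInfo, klDiv_of_ac_of_integrable hac hint', integral_congr_ae hllr,
    integral_map h.aemeasurable hmeas.aestronglyMeasurable, hval]
  simp

/-- The residual has zero variance, so the joint law sits on a line. The product of the marginals
gives that line mass zero because V has no atoms, so absolute continuity fails. -/
lemma mutualInfo_gaussian_pair_of_le_sq (h : HasGaussianLaw (fun ω => (U ω, V ω)) P)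
    (hU : Var[U; P] = 1) (hV : Var[V; P] = 1) (hc : 1 ≤ cov[U, V; P] ^ 2) :
    mutualInfo U V P = ⊤ := by
  set c := cov[U, V; P] with hcdef
  have hUl := h.fst
  have hVl := h.snd
  have := Measure.isProbabilityMeasure_map hUl.aemeasurable
  have := Measure.isProbabilityMeasure_map hVl.aemeasurable
  have := Measure.isProbabilityMeasure_map h.aemeasurable
  set R : Ω → ℝ := fun ω => V ω - c * U ω with hR
  have hU2 := hUl.memLp_two
  have hV2 := hVl.memLp_two
  have hcU : MemLp (fun ω => c * U ω) 2 P := hU2.const_mul c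
  have hR2 : MemLp R 2 P := hV2.sub hcU
  have hRvar : Var[R; P] = 1 - c ^ 2 := variance_sub_covariance_mul hU2 hV2 hU hV
  have hR0 : Var[R; P] = 0 := le_antisymm (by linarith) (variance_nonneg _ _)
  have hconst : ∀ᵐ ω ∂P, R ω = P[R] := by
    exact ae_eq_integral_of_variance_eq_zero hR2 hR0
  have hVlaw : P.map V = gaussianReal P[V] 1 := by
    rw [hVl.map_eq_gaussianReal, hV]; simp
  have hatom := nullSingletonClass_gaussianReal (μ := P[V]) (v := 1) one_ne_zero
  set s : Set (ℝ × ℝ) := {p | p.2 - c * p.1 = P[R]} with hs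
  have hsm : MeasurableSet s := measurableSet_eq_fun (by fun_prop) (by fun_prop)
  refine klDiv_of_not_ac fun hac => ?_
  have h0 : ((P.map U).prod (P.map V)) s = 0 := by
    rw [Measure.measure_prod_null hsm]
    refine Filter.Eventually.of_forall fun u => ?_
    have : Prod.mk u ⁻¹' s = {c * u + P[R]} := by
      ext v
      simp only [hs, Set.mem_preimage, Set.mem_ofPred_eq, Set.mem_singleton_iff]
      constructor <;> intro h <;> linarith
    simp only [this, hVlaw]
    simp
  have h1 : P.map (fun ω => (U ω, V ω)) s = 1 := by
    rw [Measure.map_apply_of_aemeasurable h.aemeasurable hsm, ← measure_univ (μ := P)]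
    exact measure_congr (Filter.eventuallyEq_univ.2 hconst)
  rw [hac h0] at h1
  exact zero_ne_one h1

/-- The mutual information of a Gaussian pair with unit variances. -/
lemma mutualInfo_gaussian_pair (h : HasGaussianLaw (fun ω => (U ω, V ω)) P)
    (hU : Var[U; P] = 1) (hV : Var[V; P] = 1) :
    mutualInfo U V P = gaussInfo cov[U, V; P] := by
  unfold gaussInfo
  split_ifs with hc
  · exact mutualInfo_gaussian_pair_of_sq_lt h hU hV hc
  · exact mutualInfo_gaussian_pair_of_le_sq h hU hV (not_lt.1 hc)

end Pair

/-! ### Singular value decomposition and a min-max bound. -/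

section LinearMap

variable {E F : Type*} [NormedAddCommGroup E] [InnerProductSpace ℝ E] [FiniteDimensional ℝ E]
  [NormedAddCommGroup F] [InnerProductSpace ℝ F] [FiniteDimensional ℝ F]

open Module LinearMap

/-- The orthonormal basis of right singular vectors. -/
noncomputable def rightSingularBasis (L : E →ₗ[ℝ] F) {n : ℕ} (hn : finrank ℝ E = n) :
    OrthonormalBasis (Fin n) ℝ E :=
  L.isSymmetric_adjoint_comp_self.eigenvectorBasis hn

lemma adjoint_apply_rightSingularBasis (L : E →ₗ[ℝ] F) {n : ℕ} (hn : finrank ℝ E = n)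
    (i : Fin n) :
    adjoint L (L (rightSingularBasis L hn i)) =
      (L.singularValues i ^ 2) • rightSingularBasis L hn i := by
  rw [L.sq_singularValues_fin hn]
  exact L.isSymmetric_adjoint_comp_self.apply_eigenvectorBasis hn i

lemma inner_map_rightSingularBasis (L : E →ₗ[ℝ] F) {n : ℕ} (hn : finrank ℝ E = n)
    (i : Fin n) (x : E) :
    inner ℝ (L (rightSingularBasis L hn i)) (L x) =
      L.singularValues i ^ 2 * inner ℝ (rightSingularBasis L hn i) x := by
  rw [← adjoint_inner_left, adjoint_apply_rightSingularBasis, real_inner_smul_left]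

/-- Take an eigenbasis v of L*L. The vectors L vⱼ / σⱼ with σⱼ > 0 are orthonormal, and any
extension to an orthonormal basis serves as u. -/
lemma exists_singular_bases (L : E →ₗ[ℝ] F) {m n : ℕ} (hm : finrank ℝ F = m)
    (hn : finrank ℝ E = n) :
    ∃ (u : OrthonormalBasis (Fin m) ℝ F) (v : OrthonormalBasis (Fin n) ℝ E),
      ∀ i (him : i < m) (hin : i < n),
        L (v ⟨i, hin⟩) = L.singularValues i • u ⟨i, him⟩ ∧
        adjoint L (u ⟨i, him⟩) = L.singularValues i • v ⟨i, hin⟩ := by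
  set v := rightSingularBasis L hn with hv
  -- The value 0 is never used: only indices with σⱼ > 0 matter, and these lie below n.
  set w : Fin m → F := fun j =>
    if h : (j : ℕ) < n then (L.singularValues j)⁻¹ • L (v ⟨j, h⟩) else 0 with hw
  set s : Set (Fin m) := {j | 0 < L.singularValues j} with hs
  have hsn {j : ℕ} (hj : 0 < L.singularValues j) : j < n :=
    (L.singularValues_pos_iff_lt_finrank_range.1 hj).trans_le (hn ▸ L.finrank_range_le)
  have hsm {j : ℕ} (hj : 0 < L.singularValues j) : j < m :=
    (L.singularValues_pos_iff_lt_finrank_range.1 hj).trans_le (hm ▸ Submodule.finrank_le _)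
  have hvv (i j : Fin n) : inner ℝ (v i) (v j) = if i = j then (1 : ℝ) else 0 :=
    orthonormal_iff_ite.1 v.orthonormal i j
  have horth : Orthonormal ℝ (s.domRestrict w) := by
    rw [orthonormal_iff_ite]
    rintro ⟨i, hi⟩ ⟨j, hj⟩
    have hi' : 0 < L.singularValues i := hi
    have hj' : 0 < L.singularValues j := hj
    simp only [Set.domRestrict_apply, hw, dif_pos (hsn hi'), dif_pos (hsn hj'),
      real_inner_smul_left, real_inner_smul_right, hv, inner_map_rightSingularBasis]
    rw [← hv, hvv]
    by_cases hij : i = j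
    · subst hij
      simp only [if_true]
      field_simp
    · have h1 : ¬ ((⟨i, hsn hi'⟩ : Fin n) = ⟨j, hsn hj'⟩) := by
        simpa [Fin.ext_iff] using hij
      simp [h1, hij]
  obtain ⟨u, hu⟩ := horth.exists_orthonormalBasis_extension_of_card_eq (by simp [hm])
  have hpos {i : ℕ} (hi : 0 < L.singularValues i) :
      L (v ⟨i, hsn hi⟩) = L.singularValues i • u ⟨i, hsm hi⟩ := by
    rw [hu ⟨i, hsm hi⟩ hi]
    simp only [hw, dif_pos (hsn hi), smul_smul, mul_inv_cancel₀ hi.ne', one_smul]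
  have hzero (i : Fin n) (hi : L.singularValues i = 0) : L (v i) = 0 := by
    rw [← inner_self_eq_zero (𝕜 := ℝ), hv, inner_map_rightSingularBasis, hi]
    simp
  refine ⟨u, v, fun i him hin => ?_⟩
  rcases (L.singularValues_nonneg i).eq_or_lt with hi | hi
  · refine ⟨by rw [hzero ⟨i, hin⟩ hi.symm, ← hi, zero_smul], ?_⟩
    rw [← hi, zero_smul]
    -- For σᵢ = 0, each L vⱼ is either 0 or a multiple of uⱼ with j ≠ i, so uᵢ is orthogonal to the
    -- range of L.
    refine InnerProductSpace.ext_inner_right_basis v.toBasis fun j => ?_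
    rw [inner_zero_left, v.coe_toBasis, adjoint_inner_left]
    rcases (L.singularValues_nonneg j).eq_or_lt with hj | hj
    · rw [hzero j hj.symm, inner_zero_right]
    · have hij : (⟨i, him⟩ : Fin m) ≠ ⟨j, hsm hj⟩ := by
        rintro h
        simp only [Fin.mk.injEq] at h
        rw [h] at hi
        exact hj.ne hi
      rw [hpos hj, real_inner_smul_right, u.orthonormal.2 hij, mul_zero]
  · refine ⟨hpos hi, ?_⟩
    rw [hu ⟨i, him⟩ hi]
    simp only [hw, dif_pos hin, map_smul]
    rw [hv, adjoint_apply_rightSingularBasis, smul_smul]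
    congr 1
    field_simp

/-- The min-max lower bound for singular values. -/
lemma le_singularValues_of_isometry (L : E →ₗ[ℝ] F) {i : ℕ}
    (f : EuclideanSpace ℝ (Fin (i + 1)) →ₗ[ℝ] E) (hf : ∀ a, ‖f a‖ = ‖a‖) {c : ℝ}
    (hc : ∀ a, c * ‖a‖ ≤ ‖L (f a)‖) : c ≤ L.singularValues i := by
  set v := rightSingularBasis L rfl with hv
  have hinj : Function.Injective f := by
    rw [← LinearMap.ker_eq_bot, LinearMap.ker_eq_bot']
    intro a ha
    rw [← norm_eq_zero, ← hf, ha, norm_zero]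
  have hin : i < finrank ℝ E := by
    have := LinearMap.finrank_le_finrank_of_injective hinj
    simp at this
    omega
  -- These i linear conditions on an (i + 1)-dimensional space leave a nonzero a with f a orthogonal
  -- to the first i right singular vectors; on such vectors L stretches by at most σᵢ.
  let g : EuclideanSpace ℝ (Fin (i + 1)) →ₗ[ℝ] (Fin i → ℝ) :=
    LinearMap.pi fun j => (innerₛₗ ℝ (v ⟨j, j.2.trans hin⟩)) ∘ₗ f
  obtain ⟨a, ha, ha0⟩ := Submodule.exists_mem_ne_zero_of_ne_bot
    (LinearMap.ker_ne_bot_of_finrank_lt (f := g) (by simp))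
  have hg (j : Fin (finrank ℝ E)) (hj : (j : ℕ) < i) : inner ℝ (v j) (f a) = 0 :=
    congrFun (LinearMap.mem_ker.1 ha) ⟨j, hj⟩
  have hpos : 0 < ‖a‖ := norm_pos_iff.2 ha0
  have hle : ‖L (f a)‖ ^ 2 ≤ (L.singularValues i * ‖a‖) ^ 2 := by
    rw [mul_pow, ← hf, ← v.sum_sq_norm_inner_right (f a), ← real_inner_self_eq_norm_sq]
    nth_rewrite 1 [← v.sum_repr' (f a)]
    rw [map_sum, sum_inner, Finset.mul_sum]
    refine Finset.sum_le_sum fun j _ => ?_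
    rw [map_smul, real_inner_smul_left, hv, inner_map_rightSingularBasis, ← hv]
    rcases lt_or_ge (j : ℕ) i with hj | hj
    · simp [hg j hj]
    · have h1 : L.singularValues j ^ 2 ≤ L.singularValues i ^ 2 := by
        have := L.singularValues_nonneg j
        have := L.singularValues_antitone hj
        gcongr
      rw [Real.norm_eq_abs, sq_abs]
      nlinarith [mul_le_mul_of_nonneg_right h1 (sq_nonneg (inner ℝ (v j) (f a)))]
  have := abs_le_of_sq_le_sq' hle
    (mul_nonneg (L.singularValues_nonneg i) hpos.le)
  exact le_of_mul_le_mul_right ((hc a).trans this.2) hpos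

end LinearMap

/-! ### Singular values and traces of compressed matrices. -/

section Matrix

open Module

variable {m n k : ℕ}

lemma exists_isTopSingular (T : Matrix (Fin m) (Fin n) ℝ) (hkm : k ≤ m) (hkn : k ≤ n) :
    ∃ (U : Matrix (Fin m) (Fin k) ℝ) (V : Matrix (Fin n) (Fin k) ℝ), IsTopSingular T U V := by
  obtain ⟨u, v, h⟩ := exists_singular_bases (Matrix.toEuclideanLin T)
    (m := m) (n := n) (by simp) (by simp)
  rw [← Matrix.toEuclideanLin_conjTranspose_eq_adjoint,
    Matrix.conjTranspose_eq_transpose_of_trivial] at h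
  refine ⟨Matrix.of fun a i => u (i.castLE hkm) a, Matrix.of fun a i => v (i.castLE hkn) a,
    ?_, ?_, ?_, ?_⟩
  · ext i j
    have := orthonormal_iff_ite.1 u.orthonormal (i.castLE hkm) (j.castLE hkm)
    simpa [PiLp.inner_apply, Matrix.mul_apply, Matrix.one_apply, mul_comm] using this
  · ext i j
    have := orthonormal_iff_ite.1 v.orthonormal (i.castLE hkn) (j.castLE hkn)
    simpa [PiLp.inner_apply, Matrix.mul_apply, Matrix.one_apply, mul_comm] using this
  · ext a i
    have := congrArg (fun x => x a) (h i (i.2.trans_le hkm) (i.2.trans_le hkn)).1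
    rw [Matrix.mul_diagonal]
    simpa [Matrix.mul_apply, Matrix.mulVec, dotProduct, sv, mul_comm, Fin.castLE] using this
  · ext a i
    have := congrArg (fun x => x a) (h i (i.2.trans_le hkm) (i.2.trans_le hkn)).2
    rw [Matrix.mul_diagonal]
    simpa [Matrix.mul_apply, Matrix.mulVec, dotProduct, sv, mul_comm, Fin.castLE] using this

lemma sv_nonneg (T : Matrix (Fin m) (Fin n) ℝ) (i : ℕ) : 0 ≤ sv T i :=
  (Matrix.toEuclideanLin T).singularValues_nonneg i

lemma sv_antitone (T : Matrix (Fin m) (Fin n) ℝ) : Antitone (sv T) :=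
  (Matrix.toEuclideanLin T).singularValues_antitone

lemma IsTopSingular.transpose_mul_mul {T : Matrix (Fin m) (Fin n) ℝ}
    {U : Matrix (Fin m) (Fin k) ℝ} {V : Matrix (Fin n) (Fin k) ℝ} (h : IsTopSingular T U V) :
    Uᵀ * T * V = Matrix.diagonal (fun i : Fin k => sv T i) := by
  rw [Matrix.mul_assoc, h.mul_right, ← Matrix.mul_assoc, h.left_orthonormal, Matrix.one_mul]

lemma mulVec_dotProduct_mulVec_self {A : Matrix (Fin m) (Fin k) ℝ} (hA : Aᵀ * A = 1)
    (x : Fin k → ℝ) : (A *ᵥ x) ⬝ᵥ (A *ᵥ x) = x ⬝ᵥ x := by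
  rw [Matrix.dotProduct_mulVec, ← Matrix.mulVec_transpose, Matrix.mulVec_mulVec, hA,
    Matrix.one_mulVec]

/-- The transpose of an isometry is a contraction. -/
lemma transpose_mulVec_dotProduct_self_le {A : Matrix (Fin m) (Fin k) ℝ} (hA : Aᵀ * A = 1)
    (y : Fin m → ℝ) : (Aᵀ *ᵥ y) ⬝ᵥ (Aᵀ *ᵥ y) ≤ y ⬝ᵥ y := by
  have h1 : (A *ᵥ (Aᵀ *ᵥ y)) ⬝ᵥ y = (Aᵀ *ᵥ y) ⬝ᵥ (Aᵀ *ᵥ y) := by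
    rw [dotProduct_comm, Matrix.dotProduct_mulVec, ← Matrix.mulVec_transpose]
  have h2 := mulVec_dotProduct_mulVec_self hA (Aᵀ *ᵥ y)
  -- This squared distance from y to the column space of A equals ‖y‖² - ‖Aᵀy‖².
  have h3 : 0 ≤ (y - A *ᵥ (Aᵀ *ᵥ y)) ⬝ᵥ (y - A *ᵥ (Aᵀ *ᵥ y)) :=
    Finset.sum_nonneg fun i _ => mul_self_nonneg _
  rw [sub_dotProduct, dotProduct_sub, dotProduct_sub, dotProduct_comm y (A *ᵥ _), h1, h2]
    at h3
  linarith

lemma norm_sq_toLp (x : Fin k → ℝ) : ‖WithLp.toLp 2 x‖ ^ 2 = x ⬝ᵥ x := by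
  rw [EuclideanSpace.real_norm_sq_eq]
  simp [dotProduct, sq]

/-- Singular values do not increase under compression by isometries. -/
lemma le_sv_of_compression_eq_diagonal {T : Matrix (Fin m) (Fin n) ℝ}
    {U : Matrix (Fin m) (Fin k) ℝ} {V : Matrix (Fin n) (Fin k) ℝ} (hU : Uᵀ * U = 1)
    (hV : Vᵀ * V = 1) {d : ℕ → ℝ} (hd : Antitone d) (hd0 : ∀ i, 0 ≤ d i)
    (h : Uᵀ * T * V = Matrix.diagonal (fun i : Fin k => d i)) {i : ℕ} (hi : i < k) :
    d i ≤ sv T i := by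
  -- Only the first i + 1 columns are kept: the diagonal entries that remain are all at least d i,
  -- so the compression stretches by at least d i.
  set e : Fin (i + 1) → Fin k := Fin.castLE hi with he
  have hinj : Function.Injective e := Fin.castLE_injective hi
  set U' := U.submatrix id e with hU'
  set V' := V.submatrix id e with hV'
  have hUU : U'ᵀ * U' = 1 := by
    rw [hU', Matrix.transpose_submatrix, ← Matrix.submatrix_mul _ _ _ _ _ Function.bijective_id,
      hU, Matrix.submatrix_one _ hinj]
  have hVV : V'ᵀ * V' = 1 := by
    rw [hV', Matrix.transpose_submatrix, ← Matrix.submatrix_mul _ _ _ _ _ Function.bijective_id,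
      hV, Matrix.submatrix_one _ hinj]
  have hUTV : U'ᵀ * T * V' = Matrix.diagonal (fun j : Fin (i + 1) => d j) := by
    have : U'ᵀ * T * V' = (Uᵀ * T * V).submatrix e e := rfl
    rw [this, h, Matrix.submatrix_diagonal _ _ hinj]
    rfl
  refine le_singularValues_of_isometry (Matrix.toEuclideanLin T) (Matrix.toEuclideanLin V')
    (fun a => ?_) (fun a => ?_)
  · rw [← sq_eq_sq₀ (norm_nonneg _) (norm_nonneg _)]
    exact (norm_sq_toLp (V' *ᵥ a.ofLp)).trans
      ((mulVec_dotProduct_mulVec_self hVV _).trans (norm_sq_toLp a.ofLp).symm)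
  · have h0 := hd0 i
    rw [← sq_le_sq₀ (by positivity) (norm_nonneg _), mul_pow]
    have h1 : ‖a‖ ^ 2 = a.ofLp ⬝ᵥ a.ofLp := norm_sq_toLp a.ofLp
    have h2 : ‖Matrix.toEuclideanLin T (Matrix.toEuclideanLin V' a)‖ ^ 2 =
      (T *ᵥ (V' *ᵥ a.ofLp)) ⬝ᵥ (T *ᵥ (V' *ᵥ a.ofLp)) := norm_sq_toLp _
    rw [h1, h2]
    -- U'ᵀ is a contraction, so T V' a is at least as long as U'ᵀ T V' a, which is diagonal in a.
    refine le_trans ?_ (transpose_mulVec_dotProduct_self_le hUU _)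
    rw [Matrix.mulVec_mulVec, Matrix.mulVec_mulVec, hUTV, dotProduct,
      dotProduct, Finset.mul_sum]
    refine Finset.sum_le_sum fun j _ => ?_
    have hj : d i ≤ d j := hd (Nat.lt_succ_iff.1 j.2)
    rw [Matrix.mulVec_diagonal]
    nlinarith [mul_le_mul_of_nonneg_right (pow_le_pow_left₀ h0 hj 2) (mul_self_nonneg (a.ofLp j))]

lemma orthogonal_apply_le_one {Q : Matrix (Fin m) (Fin k) ℝ} (hQ : Qᵀ * Q = 1) (i : Fin m)
    (j : Fin k) : Q i j ^ 2 ≤ 1 := by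
  have h : ∑ a, Q a j * Q a j = 1 := by
    have := congrFun (congrFun hQ j) j
    simpa [Matrix.mul_apply] using this
  rw [← h, sq]
  exact Finset.single_le_sum (f := fun a => Q a j * Q a j) (fun a _ => mul_self_nonneg _)
    (Finset.mem_univ i)

/-- The trace of a square matrix is at most the sum of its singular values. -/
lemma trace_le_sum_sv (M : Matrix (Fin k) (Fin k) ℝ) : M.trace ≤ ∑ i : Fin k, sv M i := by
  obtain ⟨U, V, h⟩ := exists_isTopSingular M le_rfl le_rfl
  have hV' : V * Vᵀ = 1 := mul_eq_one_comm.1 h.right_orthonormal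
  have hM : M = U * Matrix.diagonal (fun i : Fin k => sv M i) * Vᵀ := by
    rw [← h.mul_right, Matrix.mul_assoc, hV', Matrix.mul_one]
  -- The trace is ∑ Qᵢᵢ σᵢ with Q = VᵀU orthogonal, and the entries of Q are at most 1.
  have hQ : (Vᵀ * U)ᵀ * (Vᵀ * U) = 1 := by
    rw [Matrix.transpose_mul, Matrix.transpose_transpose, Matrix.mul_assoc, ← Matrix.mul_assoc V,
      hV', Matrix.one_mul, h.left_orthonormal]
  have htr : M.trace = ((Vᵀ * U) * Matrix.diagonal (fun i : Fin k => sv M i)).trace := by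
    conv_lhs => rw [hM, Matrix.trace_mul_comm, ← Matrix.mul_assoc]
  rw [htr, Matrix.trace]
  refine Finset.sum_le_sum fun i _ => ?_
  rw [Matrix.diag_apply, Matrix.mul_diagonal]
  have h1 : (Vᵀ * U) i i ≤ 1 := (abs_le.1 (sq_le_one_iff_abs_le_one _ |>.1
    (orthogonal_apply_le_one hQ i i))).2
  nlinarith [sv_nonneg M i]

/-- Absorbing the singular vectors O, R of the compression into UO and VR keeps the columns
orthonormal and reduces to a diagonal compression. -/
lemma sv_compression_le {T : Matrix (Fin m) (Fin n) ℝ} {U : Matrix (Fin m) (Fin k) ℝ}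
    {V : Matrix (Fin n) (Fin k) ℝ} (hU : Uᵀ * U = 1) (hV : Vᵀ * V = 1) {i : ℕ} (hi : i < k) :
    sv (Uᵀ * T * V) i ≤ sv T i := by
  obtain ⟨O, R, h⟩ := exists_isTopSingular (Uᵀ * T * V) (k := k) le_rfl le_rfl
  refine le_sv_of_compression_eq_diagonal (U := U * O) (V := V * R) ?_ ?_ (sv_antitone _)
    (sv_nonneg _) ?_ hi
  · rw [Matrix.transpose_mul, Matrix.mul_assoc, ← Matrix.mul_assoc Uᵀ, hU, Matrix.one_mul,
      h.left_orthonormal]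
  · rw [Matrix.transpose_mul, Matrix.mul_assoc, ← Matrix.mul_assoc Vᵀ, hV, Matrix.one_mul,
      h.right_orthonormal]
  · rw [← h.transpose_mul_mul, Matrix.transpose_mul]
    simp only [Matrix.mul_assoc]

lemma trace_compression_le {T : Matrix (Fin m) (Fin n) ℝ} {U : Matrix (Fin m) (Fin k) ℝ}
    {V : Matrix (Fin n) (Fin k) ℝ} (hU : Uᵀ * U = 1) (hV : Vᵀ * V = 1) :
    (Uᵀ * T * V).trace ≤ ∑ i : Fin k, sv T i :=
  (trace_le_sum_sv _).trans (Finset.sum_le_sum fun i _ => sv_compression_le hU hV i.2)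

/-- A compression of maximal trace has the same leading singular values. -/
lemma sv_compression_eq_of_sum_le_trace {T : Matrix (Fin m) (Fin n) ℝ}
    {U : Matrix (Fin m) (Fin k) ℝ} {V : Matrix (Fin n) (Fin k) ℝ} (hU : Uᵀ * U = 1)
    (hV : Vᵀ * V = 1) (h : ∑ i : Fin k, sv T i ≤ (Uᵀ * T * V).trace) (i : Fin k) :
    sv (Uᵀ * T * V) i = sv T i := by
  have hle (j : Fin k) (_ : j ∈ Finset.univ) : sv (Uᵀ * T * V) j ≤ sv T j :=
    sv_compression_le hU hV j.2
  -- The chain ∑ σ(T) ≤ tr ≤ ∑ σ(UᵀTV) ≤ ∑ σ(T) collapses, and the last inequality holds term by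
  -- term.
  exact (Finset.sum_eq_sum_iff_of_le hle).1
    (le_antisymm (Finset.sum_le_sum hle) (h.trans (trace_le_sum_sv _))) i (Finset.mem_univ i)

end Matrix

/-! ### Square roots of positive definite matrices and whitening. -/

section SquareRoot

variable {d k : ℕ} {S : Matrix (Fin d) (Fin d) ℝ}

lemma isUnit_det_sqrt (hS : S.PosDef) : IsUnit (CFC.sqrt S).det := by
  have h := CFC.sqrt_mul_sqrt_self S (Matrix.nonneg_iff_posSemidef.2 hS.posSemidef)
  have h2 : IsUnit ((CFC.sqrt S).det * (CFC.sqrt S).det) := by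
    rw [← Matrix.det_mul, h]
    exact hS.det_pos.ne'.isUnit
  exact isUnit_of_mul_isUnit_left h2

lemma transpose_sqrt : (CFC.sqrt S)ᵀ = CFC.sqrt S := by
  have h := (Matrix.nonneg_iff_posSemidef.1 (CFC.sqrt_nonneg S)).isHermitian.eq
  rwa [Matrix.conjTranspose_eq_transpose_of_trivial] at h

lemma transpose_invSqrt : (invSqrt S)ᵀ = invSqrt S := by
  rw [invSqrt, Matrix.transpose_nonsing_inv, transpose_sqrt]

lemma isUnit_det_invSqrt (hS : S.PosDef) : IsUnit (invSqrt S).det := by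
  rw [invSqrt, Matrix.isUnit_nonsing_inv_det_iff]
  exact isUnit_det_sqrt hS

lemma invSqrt_mul_mul_invSqrt (hS : S.PosDef) : invSqrt S * S * invSqrt S = 1 := by
  have h := CFC.sqrt_mul_sqrt_self S (Matrix.nonneg_iff_posSemidef.2 hS.posSemidef)
  have h' : invSqrt S * S * invSqrt S = invSqrt S * (CFC.sqrt S * CFC.sqrt S) * invSqrt S := by
    rw [h]
  rw [h', invSqrt, ← Matrix.mul_assoc, Matrix.nonsing_inv_mul _ (isUnit_det_sqrt hS), Matrix.one_mul,
    Matrix.mul_nonsing_inv _ (isUnit_det_sqrt hS)]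

/-- The columns of a matrix of full column rank can be made `S`-orthonormal by an invertible
change of basis. -/
lemma exists_mul_orthonormal (hS : S.PosDef) {A : Matrix (Fin d) (Fin k) ℝ}
    (hA : Function.Injective A.mulVec) :
    ∃ R : Matrix (Fin k) (Fin k) ℝ, IsUnit R.det ∧ (A * R)ᵀ * S * (A * R) = 1 := by
  have h : (Aᵀ * S * A).PosDef := by
    simpa [Matrix.conjTranspose_eq_transpose_of_trivial] using hS.conjTranspose_mul_mul_same hA
  -- The inverse square root of the Gram matrix: a symmetric form of Gram–Schmidt.
  refine ⟨invSqrt (Aᵀ * S * A), isUnit_det_invSqrt h, ?_⟩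
  rw [Matrix.transpose_mul, transpose_invSqrt]
  simpa only [Matrix.mul_assoc] using invSqrt_mul_mul_invSqrt h

lemma mulVec_injective_of_mul_eq_one {A : Matrix (Fin d) (Fin k) ℝ}
    {B : Matrix (Fin k) (Fin d) ℝ} (h : B * A = 1) : Function.Injective A.mulVec := by
  intro x y hxy
  have := congrArg (B *ᵥ ·) hxy
  simpa [Matrix.mulVec_mulVec, h] using this

end SquareRoot

/-! ### Covariances of linear images and information of white Gaussian vectors. -/

section Covariance

variable {Ω : Type*} [MeasurableSpace Ω] {P : Measure Ω}
  {dx dy k l : ℕ} {X : Ω → Fin dx → ℝ} {Y : Ω → Fin dy → ℝ}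

lemma crossCov_mulVec [IsProbabilityMeasure P] (hX : MemLp X 2 P) (hY : MemLp Y 2 P)
    (M : Matrix (Fin k) (Fin dx) ℝ) (N : Matrix (Fin l) (Fin dy) ℝ) :
    crossCov (fun ω => M *ᵥ X ω) (fun ω => N *ᵥ Y ω) P = M * crossCov X Y P * Nᵀ := by
  have hX' (i) : MemLp (fun ω => X ω i) 2 P := memLp_pi_iff.1 hX i
  have hY' (i) : MemLp (fun ω => Y ω i) 2 P := memLp_pi_iff.1 hY i
  ext i j
  simp only [crossCov, Matrix.of_apply, Matrix.mulVec, dotProduct]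
  rw [covariance_fun_sum_fun_sum (fun a => (hX' a).const_mul _) fun b => (hY' b).const_mul _]
  simp only [covariance_const_mul_left, covariance_const_mul_right, Matrix.mul_apply,
    Matrix.of_apply, Matrix.transpose_apply, Finset.sum_mul]
  rw [Finset.sum_comm]
  refine Finset.sum_congr rfl fun a _ => Finset.sum_congr rfl fun b _ => ?_
  ring

lemma covariance_dotProduct [IsProbabilityMeasure P] (hX : MemLp X 2 P) (hY : MemLp Y 2 P)
    (θ : Fin dx → ℝ) (φ : Fin dy → ℝ) :
    cov[fun ω => θ ⬝ᵥ X ω, fun ω => φ ⬝ᵥ Y ω; P] = θ ⬝ᵥ crossCov X Y P *ᵥ φ := by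
  have h := congrFun (congrFun (crossCov_mulVec hX hY (Matrix.replicateRow (Fin 1) θ)
    (Matrix.replicateRow (Fin 1) φ)) 0) 0
  rw [Matrix.mul_assoc] at h
  exact h

lemma aemeasurable_dotProduct (hX : AEMeasurable X P) (θ : Fin dx → ℝ) :
    AEMeasurable (fun ω => θ ⬝ᵥ X ω) P := by
  unfold dotProduct
  fun_prop

lemma variance_dotProduct [IsProbabilityMeasure P] (hX : MemLp X 2 P) (θ : Fin dx → ℝ) :
    Var[fun ω => θ ⬝ᵥ X ω; P] = θ ⬝ᵥ covMat X P *ᵥ θ := by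
  rw [← covariance_self (aemeasurable_dotProduct hX.aemeasurable θ)]
  exact covariance_dotProduct hX hX θ θ

lemma covMat_transpose : (covMat X P)ᵀ = covMat X P := by
  ext i j
  exact covariance_comm _ _

/-- The quadratic form of a covariance matrix is a variance, hence nonnegative; nonsingularity makes
it definite. -/
lemma covMat_posDef [IsProbabilityMeasure P] (hX : MemLp X 2 P) (h : (covMat X P).det ≠ 0) :
    (covMat X P).PosDef := by
  have hps : (covMat X P).PosSemidef := by
    refine Matrix.PosSemidef.of_dotProduct_mulVec_nonneg ?_ fun θ => ?_
    · rw [Matrix.IsHermitian, Matrix.conjTranspose_eq_transpose_of_trivial, covMat_transpose]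
    · rw [star_trivial, ← variance_dotProduct hX]
      exact variance_nonneg _ _
  rw [hps.posDef_iff_isUnit, Matrix.isUnit_iff_isUnit_det]
  exact h.isUnit

/-- Mutual information is invariant under invertible changes of coordinates. -/
lemma projInfo_mul [IsProbabilityMeasure P] (hX : AEMeasurable X P) (hY : AEMeasurable Y P)
    (A : Matrix (Fin dx) (Fin k) ℝ) (B : Matrix (Fin dy) (Fin k) ℝ)
    {R S : Matrix (Fin k) (Fin k) ℝ} (hR : IsUnit R.det) (hS : IsUnit S.det) :
    projInfo X Y P (A * R) (B * S) = projInfo X Y P A B := by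
  have key (R : Matrix (Fin k) (Fin k) ℝ) (hR : IsUnit R.det) :
      ∃ e : (Fin k → ℝ) ≃ᵐ (Fin k → ℝ), ∀ x, e x = Rᵀ *ᵥ x := by
    have hR' : IsUnit Rᵀ.det := by rwa [Matrix.det_transpose]
    refine ⟨⟨⟨fun x => Rᵀ *ᵥ x, fun x => Rᵀ⁻¹ *ᵥ x, fun x => ?_, fun x => ?_⟩, ?_, ?_⟩,
      fun x => rfl⟩
    · simp [Matrix.mulVec_mulVec, Matrix.nonsing_inv_mul _ hR']
    · simp [Matrix.mulVec_mulVec, Matrix.mul_nonsing_inv _ hR']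
    · exact (Matrix.mulVecLin Rᵀ).continuous_of_finiteDimensional.measurable
    · exact (Matrix.mulVecLin Rᵀ⁻¹).continuous_of_finiteDimensional.measurable
  obtain ⟨e, he⟩ := key R hR
  obtain ⟨f, hf⟩ := key S hS
  have hA : AEMeasurable (fun ω => Aᵀ *ᵥ X ω) P :=
    (Matrix.mulVecLin Aᵀ).continuous_of_finiteDimensional.measurable.comp_aemeasurable hX
  have hB : AEMeasurable (fun ω => Bᵀ *ᵥ Y ω) P :=
    (Matrix.mulVecLin Bᵀ).continuous_of_finiteDimensional.measurable.comp_aemeasurable hY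
  unfold projInfo
  rw [← mutualInfo_comp_measurableEquiv hA hB e f]
  simp only [he, hf, Matrix.mulVec_mulVec, Matrix.transpose_mul]

/-- The mutual information of jointly Gaussian vectors with white marginals and diagonal
cross-covariance. -/
lemma mutualInfo_gaussian_diagonal [IsProbabilityMeasure P] {U V : Ω → Fin k → ℝ}
    (h : HasGaussianLaw (fun ω => (U ω, V ω)) P) (hU : covMat U P = 1) (hV : covMat V P = 1)
    {d : Fin k → ℝ} (hd : crossCov U V P = Matrix.diagonal d) :
    mutualInfo U V P = ∑ i, gaussInfo (d i) := by
  have hUU (i j) : cov[fun ω => U ω i, fun ω => U ω j; P] = (1 : Matrix (Fin k) (Fin k) ℝ) i j :=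
    congrFun (congrFun hU i) j
  have hVV (i j) : cov[fun ω => V ω i, fun ω => V ω j; P] = (1 : Matrix (Fin k) (Fin k) ℝ) i j :=
    congrFun (congrFun hV i) j
  have hUV (i j) : cov[fun ω => U ω i, fun ω => V ω j; P] = Matrix.diagonal d i j :=
    congrFun (congrFun hd i) j
  have hpair (i : Fin k) : HasGaussianLaw (fun ω => (U ω i, V ω i)) P :=
    h.map ((ContinuousLinearMap.proj (R := ℝ) (φ := fun _ : Fin k => ℝ) i).prodMap
      (ContinuousLinearMap.proj i))
  -- Whiteness and diagonality leave no covariance between distinct indices. Each pair is encoded as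
  -- a vector over `Fin 2` so that the coordinatewise Gaussian independence criterion applies.
  have hind : iIndepFun (fun i ω => (U ω i, V ω i)) P := by
    have hg : HasGaussianLaw (fun ω (i : Fin k) (j : Fin 2) => ![U ω i, V ω i] j) P := by
      refine (h.map (LinearMap.toContinuousLinearMap (LinearMap.pi fun i : Fin k =>
        LinearMap.pi ![(LinearMap.proj (R := ℝ) (φ := fun _ : Fin k => ℝ) i) ∘ₗ
            LinearMap.fst ℝ (Fin k → ℝ) (Fin k → ℝ),
          (LinearMap.proj (R := ℝ) (φ := fun _ : Fin k => ℝ) i) ∘ₗ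
            LinearMap.snd ℝ (Fin k → ℝ) (Fin k → ℝ)]))).congr ?_
      refine Filter.Eventually.of_forall fun ω => ?_
      funext i j
      fin_cases j <;> rfl
    have hi := hg.iIndepFun_of_covariance_eval
      (X := fun (i : Fin k) (j : Fin 2) ω => ![U ω i, V ω i] j) fun i j hij a b => by
        fin_cases a <;> fin_cases b
        · exact (hUU i j).trans (Matrix.one_apply_ne hij)
        · exact (hUV i j).trans (Matrix.diagonal_apply_ne _ hij)
        · exact (covariance_comm _ _).trans
            ((hUV j i).trans (Matrix.diagonal_apply_ne _ hij.symm))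
        · exact (hVV i j).trans (Matrix.one_apply_ne hij)
    exact hi.comp (fun _ f => (f 0, f 1)) fun _ => by fun_prop
  have hm := mutualInfo_pi (fun i => (hpair i).fst.aemeasurable)
    (fun i => (hpair i).snd.aemeasurable) hind
  refine hm.trans (Finset.sum_congr rfl fun i _ => ?_)
  rw [mutualInfo_gaussian_pair (hpair i), hUV, Matrix.diagonal_apply_eq]
  · rw [← covariance_self (hpair i).fst.aemeasurable, hUU, Matrix.one_apply_eq]
  · rw [← covariance_self (hpair i).snd.aemeasurable, hVV, Matrix.one_apply_eq]

end Covariance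

/-! ### CCA as compression of the correlation matrix. -/

section CCA

variable {Ω : Type*} [MeasurableSpace Ω] {P : Measure Ω}
  {dx dy k : ℕ} {X : Ω → Fin dx → ℝ} {Y : Ω → Fin dy → ℝ}

lemma CCAFeasible.mul {A : Matrix (Fin dx) (Fin k) ℝ} {B : Matrix (Fin dy) (Fin k) ℝ}
    (h : CCAFeasible X Y P A B) {O R : Matrix (Fin k) (Fin k) ℝ} (hO : Oᵀ * O = 1)
    (hR : Rᵀ * R = 1) : CCAFeasible X Y P (A * O) (B * R) := by
  have key {d : ℕ} {S : Matrix (Fin d) (Fin d) ℝ} {A : Matrix (Fin d) (Fin k) ℝ}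
      {O : Matrix (Fin k) (Fin k) ℝ} (h : Aᵀ * S * A = 1) (hO : Oᵀ * O = 1) :
      (A * O)ᵀ * S * (A * O) = 1 := by
    calc (A * O)ᵀ * S * (A * O) = Oᵀ * (Aᵀ * S * A) * O := by
          simp only [Matrix.transpose_mul, Matrix.mul_assoc]
      _ = 1 := by rw [h, Matrix.mul_one, hO]
  exact ⟨key h.1 hO, key h.2 hR⟩

/-- Rotations by singular vectors of the k × k cross-covariance preserve both whiteness and
information, and leave a diagonal cross-covariance. -/
lemma projInfo_of_feasible [IsProbabilityMeasure P] (hXY : HasGaussianLaw (fun ω => (X ω, Y ω)) P)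
    {A : Matrix (Fin dx) (Fin k) ℝ} {B : Matrix (Fin dy) (Fin k) ℝ}
    (h : CCAFeasible X Y P A B) :
    projInfo X Y P A B = ∑ i : Fin k, gaussInfo (sv (Aᵀ * crossCov X Y P * B) i) := by
  obtain ⟨O, R, hOR⟩ := exists_isTopSingular (Aᵀ * crossCov X Y P * B) (k := k) le_rfl le_rfl
  have hX2 := hXY.fst.memLp_two
  have hY2 := hXY.snd.memLp_two
  have hf := h.mul hOR.left_orthonormal hOR.right_orthonormal
  have hunit {Q : Matrix (Fin k) (Fin k) ℝ} (hQ : Qᵀ * Q = 1) : IsUnit Q.det :=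
    Matrix.isUnit_det_of_left_inverse hQ
  rw [← projInfo_mul hXY.fst.aemeasurable hXY.snd.aemeasurable A B
    (hunit hOR.left_orthonormal) (hunit hOR.right_orthonormal)]
  refine mutualInfo_gaussian_diagonal ?_ ?_ ?_ ?_
  · exact hXY.map ((LinearMap.toContinuousLinearMap (Matrix.mulVecLin (A * O)ᵀ)).prodMap
      (LinearMap.toContinuousLinearMap (Matrix.mulVecLin (B * R)ᵀ)))
  · rw [covMat, crossCov_mulVec hX2 hX2, Matrix.transpose_transpose]
    exact hf.1
  · rw [covMat, crossCov_mulVec hY2 hY2, Matrix.transpose_transpose]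
    exact hf.2
  · rw [crossCov_mulVec hX2 hY2, ← hOR.transpose_mul_mul]
    simp only [Matrix.transpose_mul, Matrix.transpose_transpose, Matrix.mul_assoc]

lemma invSqrt_mul_orthonormal {d : ℕ} {S : Matrix (Fin d) (Fin d) ℝ} (hS : S.PosDef)
    {U : Matrix (Fin d) (Fin k) ℝ} (hU : Uᵀ * U = 1) :
    (invSqrt S * U)ᵀ * S * (invSqrt S * U) = 1 := by
  calc (invSqrt S * U)ᵀ * S * (invSqrt S * U) = Uᵀ * (invSqrt S * S * invSqrt S) * U := by
        simp only [Matrix.transpose_mul, transpose_invSqrt, Matrix.mul_assoc]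
    _ = 1 := by rw [invSqrt_mul_mul_invSqrt hS, Matrix.mul_one, hU]

lemma sqrt_mul_orthonormal {d : ℕ} {S : Matrix (Fin d) (Fin d) ℝ} (hS : S.PosDef)
    {A : Matrix (Fin d) (Fin k) ℝ} (hA : Aᵀ * S * A = 1) :
    (CFC.sqrt S * A)ᵀ * (CFC.sqrt S * A) = 1 := by
  have h := CFC.sqrt_mul_sqrt_self S (Matrix.nonneg_iff_posSemidef.2 hS.posSemidef)
  rw [Matrix.transpose_mul, transpose_sqrt, Matrix.mul_assoc, ← Matrix.mul_assoc (CFC.sqrt S),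
    h, ← Matrix.mul_assoc, hA]

lemma invSqrt_mul_sqrt_mul {d : ℕ} {S : Matrix (Fin d) (Fin d) ℝ} (hS : S.PosDef)
    (A : Matrix (Fin d) (Fin k) ℝ) : invSqrt S * (CFC.sqrt S * A) = A := by
  rw [invSqrt, ← Matrix.mul_assoc, Matrix.nonsing_inv_mul _ (isUnit_det_sqrt hS), Matrix.one_mul]

lemma compression_corrMat (U : Matrix (Fin dx) (Fin k) ℝ) (V : Matrix (Fin dy) (Fin k) ℝ) :
    (invSqrt (covMat X P) * U)ᵀ * crossCov X Y P * (invSqrt (covMat Y P) * V) =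
      Uᵀ * corrMat X Y P * V := by
  simp only [corrMat, Matrix.transpose_mul, transpose_invSqrt, Matrix.mul_assoc]

/-- The witnesses are Σ_X^{1/2}A and Σ_Y^{1/2}B. -/
lemma CCAFeasible.exists_compression (hX : (covMat X P).PosDef) (hY : (covMat Y P).PosDef)
    {A : Matrix (Fin dx) (Fin k) ℝ} {B : Matrix (Fin dy) (Fin k) ℝ}
    (h : CCAFeasible X Y P A B) :
    ∃ (U : Matrix (Fin dx) (Fin k) ℝ) (V : Matrix (Fin dy) (Fin k) ℝ), Uᵀ * U = 1 ∧ Vᵀ * V = 1 ∧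
      Aᵀ * crossCov X Y P * B = Uᵀ * corrMat X Y P * V :=
  ⟨_, _, sqrt_mul_orthonormal hX h.1, sqrt_mul_orthonormal hY h.2, by
    rw [← compression_corrMat, invSqrt_mul_sqrt_mul hX, invSqrt_mul_sqrt_mul hY]⟩

lemma IsTopSingular.feasible (hX : (covMat X P).PosDef) (hY : (covMat Y P).PosDef)
    {U : Matrix (Fin dx) (Fin k) ℝ} {V : Matrix (Fin dy) (Fin k) ℝ}
    (h : IsTopSingular (corrMat X Y P) U V) :
    CCAFeasible X Y P (invSqrt (covMat X P) * U) (invSqrt (covMat Y P) * V) :=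
  ⟨invSqrt_mul_orthonormal hX h.left_orthonormal, invSqrt_mul_orthonormal hY h.right_orthonormal⟩

lemma IsTopSingular.trace_eq {U : Matrix (Fin dx) (Fin k) ℝ} {V : Matrix (Fin dy) (Fin k) ℝ}
    (h : IsTopSingular (corrMat X Y P) U V) :
    ((invSqrt (covMat X P) * U)ᵀ * crossCov X Y P * (invSqrt (covMat Y P) * V)).trace =
      ∑ i : Fin k, sv (corrMat X Y P) i := by
  rw [compression_corrMat, h.transpose_mul_mul, Matrix.trace_diagonal]

lemma IsTopSingular.isCCASolution (hX : (covMat X P).PosDef) (hY : (covMat Y P).PosDef)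
    {U : Matrix (Fin dx) (Fin k) ℝ} {V : Matrix (Fin dy) (Fin k) ℝ}
    (h : IsTopSingular (corrMat X Y P) U V) :
    IsCCASolution X Y P (invSqrt (covMat X P) * U) (invSqrt (covMat Y P) * V) where
  feasible := h.feasible hX hY
  optimal A' B' h' := by
    obtain ⟨U', V', hU', hV', he⟩ := h'.exists_compression hX hY
    rw [h.trace_eq, he]
    exact trace_compression_le hU' hV'

end CCA

/-! ### Arbitrary CCA solutions, the supremum, and one-dimensional projections. -/

section CCA

variable {Ω : Type*} [MeasurableSpace Ω] {P : Measure Ω}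
  {dx dy k : ℕ} {X : Ω → Fin dx → ℝ} {Y : Ω → Fin dy → ℝ}

lemma IsCCASolution.sum_sv_le_trace (hX : (covMat X P).PosDef) (hY : (covMat Y P).PosDef)
    (hkx : k ≤ dx) (hky : k ≤ dy) {A : Matrix (Fin dx) (Fin k) ℝ}
    {B : Matrix (Fin dy) (Fin k) ℝ} (h : IsCCASolution X Y P A B) :
    ∑ i : Fin k, sv (corrMat X Y P) i ≤ (Aᵀ * crossCov X Y P * B).trace := by
  obtain ⟨U, V, hUV⟩ := exists_isTopSingular (corrMat X Y P) hkx hky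
  rw [← hUV.trace_eq]
  exact h.optimal _ _ (hUV.feasible hX hY)

/-- Solutions are not unique, but their traces all reach the extremal value, which determines the
singular values of the compression. -/
lemma IsCCASolution.sv_eq (hX : (covMat X P).PosDef) (hY : (covMat Y P).PosDef)
    (hkx : k ≤ dx) (hky : k ≤ dy) {A : Matrix (Fin dx) (Fin k) ℝ}
    {B : Matrix (Fin dy) (Fin k) ℝ} (h : IsCCASolution X Y P A B) (i : Fin k) :
    sv (Aᵀ * crossCov X Y P * B) i = sv (corrMat X Y P) i := by
  have ht := h.sum_sv_le_trace hX hY hkx hky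
  obtain ⟨U, V, hU, hV, he⟩ := h.feasible.exists_compression hX hY
  rw [he] at ht ⊢
  exact sv_compression_eq_of_sum_le_trace hU hV ht i

lemma IsCCASolution.trace_eq (hX : (covMat X P).PosDef) (hY : (covMat Y P).PosDef)
    (hkx : k ≤ dx) (hky : k ≤ dy) {A : Matrix (Fin dx) (Fin k) ℝ}
    {B : Matrix (Fin dy) (Fin k) ℝ} (h : IsCCASolution X Y P A B) :
    (Aᵀ * crossCov X Y P * B).trace = ∑ i : Fin k, sv (corrMat X Y P) i := by
  refine le_antisymm ?_ (h.sum_sv_le_trace hX hY hkx hky)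
  obtain ⟨U, V, hU, hV, he⟩ := h.feasible.exists_compression hX hY
  rw [he]
  exact trace_compression_le hU hV

lemma exists_eq_replicateCol {d : ℕ} (A : Matrix (Fin d) (Fin 1) ℝ) :
    ∃ θ, A = Matrix.replicateCol (Fin 1) θ :=
  ⟨fun i => A i 0, by ext i j; rw [Subsingleton.elim j 0]; rfl⟩

lemma transpose_mul_mul_replicateCol {m n : ℕ} (M : Matrix (Fin m) (Fin n) ℝ) (θ : Fin m → ℝ)
    (φ : Fin n → ℝ) (i j : Fin 1) :
    ((Matrix.replicateCol (Fin 1) θ)ᵀ * M * Matrix.replicateCol (Fin 1) φ) i j =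
      θ ⬝ᵥ M *ᵥ φ := by
  rw [Matrix.mul_assoc]
  rfl

lemma ccaFeasible_replicateCol_iff {θ : Fin dx → ℝ} {φ : Fin dy → ℝ} :
    CCAFeasible X Y P (Matrix.replicateCol (Fin 1) θ) (Matrix.replicateCol (Fin 1) φ) ↔
      θ ⬝ᵥ covMat X P *ᵥ θ = 1 ∧ φ ⬝ᵥ covMat Y P *ᵥ φ = 1 := by
  have key {d : ℕ} (M : Matrix (Fin d) (Fin d) ℝ) (θ : Fin d → ℝ) :
      (Matrix.replicateCol (Fin 1) θ)ᵀ * M * Matrix.replicateCol (Fin 1) θ = 1 ↔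
        θ ⬝ᵥ M *ᵥ θ = 1 := by
    refine ⟨fun h => ?_, fun h => ?_⟩
    · rw [← transpose_mul_mul_replicateCol M θ θ 0 0, h, Matrix.one_apply_eq]
    · ext i j
      rw [transpose_mul_mul_replicateCol, h, Subsingleton.elim i j, Matrix.one_apply_eq]
  exact and_congr (key _ _) (key _ _)

lemma trace_replicateCol (θ : Fin dx → ℝ) (φ : Fin dy → ℝ) :
    ((Matrix.replicateCol (Fin 1) θ)ᵀ * crossCov X Y P * Matrix.replicateCol (Fin 1) φ).trace =
      θ ⬝ᵥ crossCov X Y P *ᵥ φ := by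
  rw [Matrix.trace_fin_one, transpose_mul_mul_replicateCol]

variable [IsProbabilityMeasure P]

lemma IsCCASolution.projInfo_eq (hXY : HasGaussianLaw (fun ω => (X ω, Y ω)) P)
    (hX : (covMat X P).PosDef) (hY : (covMat Y P).PosDef)
    (hkx : k ≤ dx) (hky : k ≤ dy) {A : Matrix (Fin dx) (Fin k) ℝ}
    {B : Matrix (Fin dy) (Fin k) ℝ} (h : IsCCASolution X Y P A B) :
    projInfo X Y P A B = ∑ i : Fin k, gaussInfo (sv (corrMat X Y P) i) := by
  rw [projInfo_of_feasible hXY h.feasible]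
  exact Finset.sum_congr rfl fun i _ => by rw [h.sv_eq hX hY hkx hky]

lemma CCAFeasible.projInfo_le (hXY : HasGaussianLaw (fun ω => (X ω, Y ω)) P)
    (hX : (covMat X P).PosDef) (hY : (covMat Y P).PosDef) {A : Matrix (Fin dx) (Fin k) ℝ}
    {B : Matrix (Fin dy) (Fin k) ℝ} (h : CCAFeasible X Y P A B) :
    projInfo X Y P A B ≤ ∑ i : Fin k, gaussInfo (sv (corrMat X Y P) i) := by
  obtain ⟨U, V, hU, hV, he⟩ := h.exists_compression hX hY
  rw [projInfo_of_feasible hXY h, he]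
  exact Finset.sum_le_sum fun i _ =>
    gaussInfo_le_gaussInfo (sv_nonneg _ _) (sv_compression_le hU hV i.2)

/-- The Stiefel and CCA constraints choose different bases of the same column spaces. Renormalizing
the columns one way gives the upper bound, the other way attainment. -/
lemma mSMI_eq_sum (hXY : HasGaussianLaw (fun ω => (X ω, Y ω)) P)
    (hX : (covMat X P).PosDef) (hY : (covMat Y P).PosDef) (hkx : k ≤ dx) (hky : k ≤ dy) :
    mSMI k X Y P = ∑ i : Fin k, gaussInfo (sv (corrMat X Y P) i) := by
  have hXm := hXY.fst.aemeasurable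
  have hYm := hXY.snd.aemeasurable
  refine le_antisymm (iSup₂_le fun A hA => iSup₂_le fun B hB => ?_) ?_
  · obtain ⟨R, hR, hAR⟩ := exists_mul_orthonormal hX (mulVec_injective_of_mul_eq_one hA)
    obtain ⟨S, hS, hBS⟩ := exists_mul_orthonormal hY (mulVec_injective_of_mul_eq_one hB)
    rw [← projInfo_mul hXm hYm A B hR hS]
    exact CCAFeasible.projInfo_le hXY hX hY ⟨hAR, hBS⟩
  · obtain ⟨U, V, hUV⟩ := exists_isTopSingular (corrMat X Y P) hkx hky
    have hsol := hUV.isCCASolution hX hY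
    rw [← hsol.projInfo_eq hXY hX hY hkx hky]
    obtain ⟨R, hR, hAR⟩ := exists_mul_orthonormal Matrix.PosDef.one
      (mulVec_injective_of_mul_eq_one hsol.feasible.1)
    obtain ⟨S, hS, hBS⟩ := exists_mul_orthonormal Matrix.PosDef.one
      (mulVec_injective_of_mul_eq_one hsol.feasible.2)
    rw [Matrix.mul_one] at hAR hBS
    rw [← projInfo_mul hXm hYm _ _ hR hS]
    exact le_iSup₂_of_le _ hAR (le_iSup₂_of_le _ hBS le_rfl)

lemma projCorr_eq (hX2 : MemLp X 2 P) (hY2 : MemLp Y 2 P) (θ : Fin dx → ℝ) (φ : Fin dy → ℝ) :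
    projCorr X Y P θ φ = (θ ⬝ᵥ crossCov X Y P *ᵥ φ) /
      √((θ ⬝ᵥ covMat X P *ᵥ θ) * (φ ⬝ᵥ covMat Y P *ᵥ φ)) := by
  rw [projCorr, corr, covariance_dotProduct hX2 hY2, variance_dotProduct hX2,
    variance_dotProduct hY2]

lemma projInfo_replicateCol (hXm : AEMeasurable X P) (hYm : AEMeasurable Y P) (θ : Fin dx → ℝ)
    (φ : Fin dy → ℝ) :
    projInfo X Y P (Matrix.replicateCol (Fin 1) θ) (Matrix.replicateCol (Fin 1) φ) =
      mutualInfo (fun ω => θ ⬝ᵥ X ω) (fun ω => φ ⬝ᵥ Y ω) P :=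
  mutualInfo_comp_measurableEquiv (aemeasurable_dotProduct hXm θ) (aemeasurable_dotProduct hYm φ)
    (MeasurableEquiv.funUnique (Fin 1) ℝ).symm (MeasurableEquiv.funUnique (Fin 1) ℝ).symm

/-- Rescaling a pair of nonzero vectors to unit variances. -/
lemma exists_smul_feasible (hXY : HasGaussianLaw (fun ω => (X ω, Y ω)) P)
    (hX : (covMat X P).PosDef) (hY : (covMat Y P).PosDef) {θ : Fin dx → ℝ} {φ : Fin dy → ℝ}
    (hθ : θ ≠ 0) (hφ : φ ≠ 0) :
    ∃ A B, CCAFeasible (k := 1) X Y P A B ∧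
      (Aᵀ * crossCov X Y P * B).trace = projCorr X Y P θ φ ∧
      projInfo X Y P A B = mutualInfo (fun ω => θ ⬝ᵥ X ω) (fun ω => φ ⬝ᵥ Y ω) P := by
  have ha : 0 < θ ⬝ᵥ covMat X P *ᵥ θ := by simpa using hX.dotProduct_mulVec_pos hθ
  have hb : 0 < φ ⬝ᵥ covMat Y P *ᵥ φ := by simpa using hY.dotProduct_mulVec_pos hφ
  rw [projCorr_eq hXY.fst.memLp_two hXY.snd.memLp_two]
  set a := θ ⬝ᵥ covMat X P *ᵥ θ with ha'
  set b := φ ⬝ᵥ covMat Y P *ᵥ φ with hb'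
  have hsa := Real.sqrt_pos.2 ha
  have hsb := Real.sqrt_pos.2 hb
  have hsa2 := Real.sq_sqrt ha.le
  have hsb2 := Real.sq_sqrt hb.le
  refine ⟨Matrix.replicateCol (Fin 1) ((√a)⁻¹ • θ), Matrix.replicateCol (Fin 1) ((√b)⁻¹ • φ),
    ccaFeasible_replicateCol_iff.2 ⟨?_, ?_⟩, ?_, ?_⟩
  · rw [Matrix.mulVec_smul, smul_dotProduct, dotProduct_smul, ← ha', smul_eq_mul, smul_eq_mul]
    field_simp
    exact hsa2.symm
  · rw [Matrix.mulVec_smul, smul_dotProduct, dotProduct_smul, ← hb', smul_eq_mul, smul_eq_mul]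
    field_simp
    exact hsb2.symm
  · rw [trace_replicateCol, Matrix.mulVec_smul, smul_dotProduct, dotProduct_smul, smul_eq_mul,
      smul_eq_mul, Real.sqrt_mul ha.le]
    field_simp
  · rw [projInfo_replicateCol hXY.fst.aemeasurable hXY.snd.aemeasurable]
    have hU := aemeasurable_dotProduct hXY.fst.aemeasurable θ
    have hV := aemeasurable_dotProduct hXY.snd.aemeasurable φ
    simp only [smul_dotProduct]
    exact mutualInfo_comp_measurableEquiv hU hV
      (Homeomorph.smulOfNeZero (√a)⁻¹ (inv_ne_zero hsa.ne')).toMeasurableEquiv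
      (Homeomorph.smulOfNeZero (√b)⁻¹ (inv_ne_zero hsb.ne')).toMeasurableEquiv

lemma CCAFeasible.exists_projCorr_eq (hX2 : MemLp X 2 P) (hY2 : MemLp Y 2 P)
    {A : Matrix (Fin dx) (Fin 1) ℝ} {B : Matrix (Fin dy) (Fin 1) ℝ}
    (h : CCAFeasible X Y P A B) :
    ∃ θ φ, θ ≠ 0 ∧ φ ≠ 0 ∧ projCorr X Y P θ φ = (Aᵀ * crossCov X Y P * B).trace := by
  obtain ⟨θ, rfl⟩ := exists_eq_replicateCol A
  obtain ⟨φ, rfl⟩ := exists_eq_replicateCol B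
  obtain ⟨hθ, hφ⟩ := ccaFeasible_replicateCol_iff.1 h
  refine ⟨θ, φ, ?_, ?_, ?_⟩
  · rintro rfl; simp at hθ
  · rintro rfl; simp at hφ
  · rw [projCorr_eq hX2 hY2, hθ, hφ, trace_replicateCol]
    simp

lemma projCorr_le_sv (hXY : HasGaussianLaw (fun ω => (X ω, Y ω)) P)
    (hX : (covMat X P).PosDef) (hY : (covMat Y P).PosDef) {θ : Fin dx → ℝ} {φ : Fin dy → ℝ}
    (hθ : θ ≠ 0) (hφ : φ ≠ 0) : projCorr X Y P θ φ ≤ sv (corrMat X Y P) 0 := by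
  obtain ⟨A, B, hf, ht, -⟩ := exists_smul_feasible hXY hX hY hθ hφ
  obtain ⟨U, V, hU, hV, he⟩ := hf.exists_compression hX hY
  rw [← ht, he]
  simpa using trace_compression_le (T := corrMat X Y P) hU hV

lemma exists_projCorr_eq_sv (hXY : HasGaussianLaw (fun ω => (X ω, Y ω)) P)
    (hX : (covMat X P).PosDef) (hY : (covMat Y P).PosDef) (hx : 1 ≤ dx) (hy : 1 ≤ dy) :
    ∃ θ φ, θ ≠ 0 ∧ φ ≠ 0 ∧ projCorr X Y P θ φ = sv (corrMat X Y P) 0 := by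
  obtain ⟨U, V, hUV⟩ := exists_isTopSingular (corrMat X Y P) hx hy
  obtain ⟨θ, φ, hθ, hφ, h⟩ := (hUV.feasible hX hY).exists_projCorr_eq
    hXY.fst.memLp_two hXY.snd.memLp_two
  refine ⟨θ, φ, hθ, hφ, ?_⟩
  rw [h, hUV.trace_eq]
  simp

lemma rhoCCA_eq_sv (hXY : HasGaussianLaw (fun ω => (X ω, Y ω)) P)
    (hX : (covMat X P).PosDef) (hY : (covMat Y P).PosDef) (hx : 1 ≤ dx) (hy : 1 ≤ dy) :
    rhoCCA X Y P = sv (corrMat X Y P) 0 := by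
  refine IsGreatest.csSup_eq ⟨?_, ?_⟩
  · obtain ⟨θ, φ, hθ, hφ, h⟩ := exists_projCorr_eq_sv hXY hX hY hx hy
    exact ⟨θ, φ, hθ, hφ, h.symm⟩
  · rintro r ⟨θ, φ, hθ, hφ, rfl⟩
    exact projCorr_le_sv hXY hX hY hθ hφ

lemma exists_isCCAPair (hXY : HasGaussianLaw (fun ω => (X ω, Y ω)) P)
    (hX : (covMat X P).PosDef) (hY : (covMat Y P).PosDef) (hx : 1 ≤ dx) (hy : 1 ≤ dy) :
    ∃ θ φ, IsCCAPair X Y P θ φ := by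
  obtain ⟨θ, φ, hθ, hφ, h⟩ := exists_projCorr_eq_sv hXY hX hY hx hy
  exact ⟨θ, φ, hθ, hφ, fun θ' φ' hθ' hφ' => h ▸ projCorr_le_sv hXY hX hY hθ' hφ'⟩

/-- Rescaled to unit variances, a maximizing pair is a CCA solution for k = 1, because correlation
then equals the CCA objective. -/
lemma IsCCAPair.mSMI_eq (hXY : HasGaussianLaw (fun ω => (X ω, Y ω)) P)
    (hX : (covMat X P).PosDef) (hY : (covMat Y P).PosDef) (hx : 1 ≤ dx) (hy : 1 ≤ dy)
    {θ : Fin dx → ℝ} {φ : Fin dy → ℝ} (h : IsCCAPair X Y P θ φ) :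
    mSMI 1 X Y P = mutualInfo (fun ω => θ ⬝ᵥ X ω) (fun ω => φ ⬝ᵥ Y ω) P := by
  obtain ⟨A, B, hf, ht, hi⟩ := exists_smul_feasible hXY hX hY h.left_ne h.right_ne
  have hsol : IsCCASolution X Y P A B := ⟨hf, fun A' B' hf' => by
    obtain ⟨θ', φ', hθ', hφ', he⟩ :=
      hf'.exists_projCorr_eq hXY.fst.memLp_two hXY.snd.memLp_two
    rw [← he, ht]
    exact h.optimal _ _ hθ' hφ'⟩
  rw [← hi, hsol.projInfo_eq hXY hX hY hx hy, mSMI_eq_sum hXY hX hY hx hy]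

/-- The largest singular value is the covariance of two projections of unit variance. -/
lemma sv_corrMat_le_one (hXY : HasGaussianLaw (fun ω => (X ω, Y ω)) P)
    (hX : (covMat X P).PosDef) (hY : (covMat Y P).PosDef) (hx : 1 ≤ dx) (hy : 1 ≤ dy) (i : ℕ) :
    sv (corrMat X Y P) i ≤ 1 := by
  refine (sv_antitone _ (Nat.zero_le i)).trans ?_
  have hX2 := hXY.fst.memLp_two
  have hY2 := hXY.snd.memLp_two
  obtain ⟨U, V, hUV⟩ := exists_isTopSingular (corrMat X Y P) hx hy
  have hf := hUV.feasible hX hY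
  have ht := hUV.trace_eq
  obtain ⟨θ, hθ⟩ := exists_eq_replicateCol (invSqrt (covMat X P) * U)
  obtain ⟨φ, hφ⟩ := exists_eq_replicateCol (invSqrt (covMat Y P) * V)
  rw [hθ, hφ, ccaFeasible_replicateCol_iff] at hf
  rw [hθ, hφ, trace_replicateCol, ← covariance_dotProduct hX2 hY2, Fin.sum_univ_one] at ht
  rw [← variance_dotProduct hX2, ← variance_dotProduct hY2] at hf
  have hmem {d : ℕ} {Z : Ω → Fin d → ℝ} (hZ : MemLp Z 2 P) (ψ : Fin d → ℝ) :
      MemLp (fun ω => ψ ⬝ᵥ Z ω) 2 P :=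
    memLp_finsetSum _ fun i _ => (memLp_pi_iff.1 hZ i).const_mul _
  have h := covariance_sq_le_one (hmem hX2 θ) (hmem hY2 φ) hf.1 hf.2
  rw [ht] at h
  exact (abs_le.1 ((sq_le_one_iff_abs_le_one _).1 h)).2

end CCA

end MaxSliced

theorem proposition2 {Ω : Type*} [MeasurableSpace Ω] (P : Measure Ω) [IsProbabilityMeasure P]
    {dx dy : ℕ} (X : Ω → Fin dx → ℝ) (Y : Ω → Fin dy → ℝ)
    (hXY : HasGaussianLaw (fun ω => (X ω, Y ω)) P)
    (hX : (MaxSliced.covMat X P).det ≠ 0) (hY : (MaxSliced.covMat Y P).det ≠ 0)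
    (k : ℕ) (hk : 1 ≤ k) (hkx : k ≤ dx) (hky : k ≤ dy) :
    -- the singular values of `T_{XY}` are at most one
    (∀ i, MaxSliced.sv (MaxSliced.corrMat X Y P) i ≤ 1) ∧
    -- the CCA matrices built from singular vectors exist, and they solve the CCA problem
    (∃ (U : Matrix (Fin dx) (Fin k) ℝ) (V : Matrix (Fin dy) (Fin k) ℝ),
      MaxSliced.IsTopSingular (MaxSliced.corrMat X Y P) U V) ∧
    (∀ (U : Matrix (Fin dx) (Fin k) ℝ) (V : Matrix (Fin dy) (Fin k) ℝ),
      MaxSliced.IsTopSingular (MaxSliced.corrMat X Y P) U V →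
      MaxSliced.IsCCASolution X Y P (MaxSliced.invSqrt (MaxSliced.covMat X P) * U)
        (MaxSliced.invSqrt (MaxSliced.covMat Y P) * V)) ∧
    -- every solution of the CCA problem attains the max-sliced mutual information
    (∀ (A : Matrix (Fin dx) (Fin k) ℝ) (B : Matrix (Fin dy) (Fin k) ℝ),
      MaxSliced.IsCCASolution X Y P A B →
      MaxSliced.mSMI k X Y P = MaxSliced.projInfo X Y P A B) ∧
    -- the closed form, in the extended reals
    ((MaxSliced.mSMI k X Y P : EReal) = ((-(1 / 2) : ℝ) : EReal) *
      ∑ i ∈ Finset.range k,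
        MaxSliced.extLog (1 - MaxSliced.sv (MaxSliced.corrMat X Y P) i ^ 2)) ∧
    -- one-dimensional projections
    (∃ θ φ, MaxSliced.IsCCAPair X Y P θ φ) ∧
    (∀ θ φ, MaxSliced.IsCCAPair X Y P θ φ →
      MaxSliced.mSMI 1 X Y P =
        MaxSliced.mutualInfo (fun ω => θ ⬝ᵥ X ω) (fun ω => φ ⬝ᵥ Y ω) P) ∧
    ((MaxSliced.mSMI 1 X Y P : EReal) = ((-(1 / 2) : ℝ) : EReal) *
      MaxSliced.extLog (1 - MaxSliced.rhoCCA X Y P ^ 2)) := by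
  have hXp := MaxSliced.covMat_posDef hXY.fst.memLp_two hX
  have hYp := MaxSliced.covMat_posDef hXY.snd.memLp_two hY
  have hx := hk.trans hkx
  have hy := hk.trans hky
  have hle := MaxSliced.sv_corrMat_le_one hXY hXp hYp hx hy
  have hsq (i : ℕ) : MaxSliced.sv (MaxSliced.corrMat X Y P) i ^ 2 ≤ 1 :=
    pow_le_one₀ (MaxSliced.sv_nonneg _ i) (hle i)
  -- The dimension stays free because the formula is needed both for k and for 1.
  have hmSMI {l : ℕ} (hlx : l ≤ dx) (hly : l ≤ dy) := MaxSliced.mSMI_eq_sum hXY hXp hYp hlx hly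
  refine ⟨hle, MaxSliced.exists_isTopSingular _ hkx hky, fun U V h => h.isCCASolution hXp hYp,
    fun A B h => ?_, ?_, MaxSliced.exists_isCCAPair hXY hXp hYp hx hy,
    fun θ φ h => h.mSMI_eq hXY hXp hYp hx hy, ?_⟩
  · rw [hmSMI hkx hky, h.projInfo_eq hXY hXp hYp hkx hky]
  · rw [hmSMI hkx hky,
      Fin.sum_univ_eq_sum_range (fun i => MaxSliced.gaussInfo (MaxSliced.sv _ i)) k]
    exact MaxSliced.coe_sum_gaussInfo _ fun i _ => hsq i
  · rw [hmSMI hx hy, MaxSliced.rhoCCA_eq_sv hXY hXp hYp hx hy, Fin.sum_univ_one]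
    exact MaxSliced.coe_gaussInfo (hsq 0)
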